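/- Let $s>1$, $C>0$, and let $V:\mathbb R\to\mathbb R$ be measurable with $V(x)\ge C^{-1}|x|^s$. Let $h=-\partial_x^2+V$ be the self-adjoint operator on $L^2(\mathbb R;\mathbb C)$ associated with the quadratic form $f\mapsto\int|f'|^2+\int V|f|^2$ on $\{f\in H^1(\mathbb R):\int V|f|^2<\infty\}$ (assumed dense in $L^2(\mathbb R)$, as is the case for $V\in L^1_{\rm loc}(\mathbb R)$), with spectral decomposition $h=\sum_{n\ge0}\lambda_n|u_n\rangle\langle u_n|$, where $(u_n)_{n\ge 0}$ is an orthonormal basis of $L^2(\mathbb R)$ and $h u_n=\lambda_n u_n$. Let $\mu_0$ be the associated Gaussian measure, i.e. the unique probability measure on the formal series $u=\sum_n\alpha_nu_n$, identified with their coefficient sequences $(\alpha_n)\in\mathbb C^{\mathbb N}$ (with the cylinder $\sigma$-algebra), whose projection on the coefficients $(\alpha_0,\dots,\alpha_K)$ is, for every $K$, $$\bigotimes_{j=0}^K\frac{\lambda_j}{\pi}e^{-\lambda_j|\alpha_j|^2}\,d\alpha_j,\qquad d\alpha_j=d\,\mathrm{Re}\,\alpha_j\,d\,\mathrm{Im}\,\alpha_j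 .$$ Then: 1. For every $r$ with $\max(2,4/s)<r<\infty$, the measure $\mu_0$ is supported on $L^r(\mathbb R)$: for $\mu_0$-almost every $u=\sum_n\alpha_nu_n$ there is exactly one function in $L^r(\mathbb R)$, again denoted $u$, such that $\int_{\mathbb R}\overline{u_n}\,u\,dx=\alpha_n$ for all $n$. Moreover, there exists $\alpha_r>0$ such that $$\int e^{\alpha_r\|u\|_{L^r(\mathbb R)}^2}\,d\mu_0(u)<\infty .$$ 2. The diagonal $x\mapsto h^{-1}(x;x)=\sum_{n\ge0}\lambda_n^{-1}|u_n(x)|^2$ of the kernel of $h^{-1}$ belongs to $L^p(\mathbb R)$ for every $\max(1,2/s)<p\le\infty$. -/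

import Mathlib

open MeasureTheory
open scoped ContDiff ENNReal ComplexConjugate

noncomputable section

namespace FreeGibbs

/-- The one-particle space `L²(ℝ; ℂ)`. -/
abbrev L2 : Type := Lp ℂ 2 (volume : Measure ℝ)

/-- `g` is the weak derivative of `f` on `ℝ`. -/
def HasWeakDeriv (f g : ℝ → ℂ) : Prop :=
  ∀ φ : ℝ → ℂ, ContDiff ℝ ∞ φ → HasCompactSupport φ →
    ∫ x, deriv φ x * f x = -∫ x, φ x * g x

/-- `f` lies in the form domain `{f ∈ H¹(ℝ) : ∫ V |f|² < ∞}` of `-∂ₓ² + V`, and `f'` is its weak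
derivative. -/
structure MemFormDomain (V : ℝ → ℝ) (f f' : L2) : Prop where
  weakDeriv : HasWeakDeriv f f'
  potential : Integrable fun x => V x * ‖f x‖ ^ 2

/-- `f` lies in the domain of the operator `h = -∂ₓ² + V` on `L²(ℝ)` and `h f = g`, where `h` is
the operator associated with the quadratic form `f ↦ ∫ |f'|² + ∫ V |f|²`. -/
def SchrodingerApply (V : ℝ → ℝ) (f g : L2) : Prop :=
  ∃ f' : L2, MemFormDomain V f f' ∧ ∀ φ φ' : L2, MemFormDomain V φ φ' →
    (∫ x, conj (φ' x) * f' x) + (∫ x, (V x : ℂ) * (conj (φ x) * f x)) = ∫ x, conj (φ x) * g x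

/-- The spectral decomposition `h = ∑ₙ λₙ |uₙ⟩⟨uₙ|`: the `uₙ` form an orthonormal basis of `L²(ℝ)`
and `h uₙ = λₙ uₙ`. -/
def IsSpectralDecomposition (V : ℝ → ℝ) (lam : ℕ → ℝ) (u : HilbertBasis ℕ ℂ L2) : Prop :=
  ∀ n, SchrodingerApply V (u n) ((lam n : ℂ) • u n)

/-- The measure `(l / π) exp (-l |z|²) da db` on `ℂ`, `z = a + i b`. -/
def complexGaussian (l : ℝ) : Measure ℂ :=
  volume.withDensity fun z => ENNReal.ofReal (l / Real.pi * Real.exp (-l * ‖z‖ ^ 2))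

/-- `μ` is the Gaussian measure with cylindrical projections
`⊗_{j ≤ K} (λⱼ / π) exp (-λⱼ |αⱼ|²) dαⱼ`. A formal series `∑ₙ αₙ uₙ` is identified with its
coefficient sequence `α`, and `ℕ → ℂ` carries the cylinder σ-algebra. -/
structure IsFreeGibbsMeasure (lam : ℕ → ℝ) (μ : Measure (ℕ → ℂ)) : Prop where
  isProb : IsProbabilityMeasure μ
  proj : ∀ K : ℕ, μ.map (fun (α : ℕ → ℂ) (j : Fin (K + 1)) => α j) =
    Measure.pi fun j : Fin (K + 1) => complexGaussian (lam j)

/-- The function `f` has coefficients `⟨uₙ, f⟩ = αₙ`, i.e. it is the function represented by the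
formal series `∑ₙ αₙ uₙ`. -/
def HasCoeffs (u : HilbertBasis ℕ ℂ L2) (f : ℝ → ℂ) (α : ℕ → ℂ) : Prop :=
  ∀ n, Integrable (fun x => conj (u n x) * f x) ∧ ∫ x, conj (u n x) * f x = α n

open Classical in
/-- The element of `L^r(ℝ)` represented by `∑ₙ αₙ uₙ` (and `0` if there is none). -/
def toLr (u : HilbertBasis ℕ ℂ L2) (r : ℝ) (α : ℕ → ℂ) :
    Lp ℂ (ENNReal.ofReal r) (volume : Measure ℝ) :=
  if h : ∃ f : Lp ℂ (ENNReal.ofReal r) (volume : Measure ℝ), HasCoeffs u f α then h.choose else 0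

/-- The diagonal `h⁻¹(x; x) = ∑ₙ λₙ⁻¹ |uₙ(x)|²` of the kernel of `h⁻¹`. -/
def greenDiag (lam : ℕ → ℝ) (u : HilbertBasis ℕ ℂ L2) (x : ℝ) : ℝ≥0∞ :=
  ∑' n, ENNReal.ofReal (‖u n x‖ ^ 2 / lam n)

theorem isProbabilityMeasure_complexGaussian {l : ℝ} (hl : 0 < l) :
    IsProbabilityMeasure (complexGaussian l) := by
  have h1 : ∫ z : ℂ, Real.exp (-l * ‖z‖ ^ 2) = Real.pi / l := by
    have := GaussianFourier.integral_rexp_neg_mul_sq_norm (V := ℂ) hl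
    rw [this, Complex.finrank_real_complex]
    norm_num
  have h2 : Integrable fun z : ℂ => Real.exp (-l * ‖z‖ ^ 2) := by
    by_contra h
    rw [integral_undef h] at h1
    have := div_pos Real.pi_pos hl
    linarith
  constructor
  rw [complexGaussian, withDensity_apply _ MeasurableSet.univ, Measure.restrict_univ,
    ← ofReal_integral_eq_lintegral_ofReal (h2.const_mul _)
      (Filter.Eventually.of_forall fun z => by have := Real.pi_pos; positivity),
    integral_const_mul, h1]
  have := Real.pi_pos
  rw [show l / Real.pi * (Real.pi / l) = 1 by field_simp]
  simp

/-- The Gaussian measure exists. -/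
theorem exists_isFreeGibbsMeasure {lam : ℕ → ℝ} (hlam : ∀ n, 0 < lam n) :
    ∃ μ, IsFreeGibbsMeasure lam μ := by
  have : ∀ n, IsProbabilityMeasure (complexGaussian (lam n)) := fun n =>
    isProbabilityMeasure_complexGaussian (hlam n)
  refine ⟨Measure.infinitePi fun n => complexGaussian (lam n), inferInstance, fun K => ?_⟩
  symm
  refine Measure.pi_eq fun t ht => ?_
  have hm : Measurable (fun (α : ℕ → ℂ) (j : Fin (K + 1)) => α j) := by fun_prop
  rw [Measure.map_apply hm (MeasurableSet.univ_pi ht)]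
  have key := Measure.infinitePi_pi (fun n => complexGaussian (lam n))
    (s := Finset.range (K + 1))
    (t := fun n => if h : n < K + 1 then t ⟨n, h⟩ else Set.univ)
    (fun n hn => by
      simp only [Finset.mem_range.mp hn, dite_true]
      exact ht _)
  rw [Finset.prod_range] at key
  simp only [Fin.is_lt, dite_true, Fin.eta] at key
  rw [← key]
  congr 1
  ext α
  simp only [Set.mem_preimage, Set.mem_pi, Set.mem_univ, true_imp_iff, Finset.coe_range,
    Set.mem_Iio]
  constructor
  · intro h n hn
    simpa [hn] using h ⟨n, hn⟩
  · intro h j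
    have := h j j.2
    rwa [dif_pos j.2] at this

end FreeGibbs

end

/-!
Comparing `f x` with the values of `f` on an interval of length of order `|x| ^ (-s / 2)` bounds
`|f x|²` by `K x` times the energy `∫ |f'|² + ∫ V |f|²`, where `K x = O(|x| ^ (-s / 2))`. The `uₙ`
are orthogonal in the energy space with squared norms `λₙ`, so by duality `∑ₙ λₙ⁻¹ |uₙ|² ≤ K` almost
everywhere, and `K ∈ L^p` for `2 / s < p`.

Under `μ₀` the partial sums at a point `x` are complex Gaussian with variance at most `K x`, so
their moments are controlled by powers of `K x`. Integrating over `x` bounds the exponential moments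
of the `L^r` norms of the partial sums uniformly, and the same estimate for the tails makes a
subsequence converge in `L^r` almost surely; Fatou's lemma then passes the exponential moment to the
limit.

For uniqueness, let `f ∈ L^r` have vanishing coefficients. Functions of finite energy belong to the
dual `L^q` and are approximated there by combinations of the `uₙ`, so `f` is orthogonal to them.
They include `χ uₙ` for every test function `χ`; hence `conj uₙ * f = 0` for all `n`, and almost
nowhere do all `uₙ` vanish.
-/

noncomputable section

open Filter
open scoped InnerProductSpace Topology

namespace FreeGibbs

section WeakDerivative

theorem exists_tsupport_subset_Ioo {E : Type*} [Zero E] {φ : ℝ → E} (hφc : HasCompactSupport φ) :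
    ∃ b : ℝ, 0 < b ∧ tsupport φ ⊆ Set.Ioo (-b) b := by
  obtain ⟨b, hb, hsub⟩ := hφc.isCompact.isBounded.subset_ball_lt 0 0
  exact ⟨b, hb, by simpa [Real.ball_eq_Ioo] using hsub⟩

variable {E : Type*} [NormedAddCommGroup E] [NormedSpace ℝ E]

theorem contDiff_deriv_of_contDiff {φ : ℝ → E} (hφ : ContDiff ℝ ∞ φ) : ContDiff ℝ ∞ (deriv φ) :=
  (contDiff_infty_iff_deriv.mp hφ).2

theorem exists_testFunction_deriv_eq [CompleteSpace E] {ψ : ℝ → E} (hψ : ContDiff ℝ ∞ ψ)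
    (hψc : HasCompactSupport ψ) (hψ0 : ∫ x, ψ x = 0) :
    ∃ φ : ℝ → E, ContDiff ℝ ∞ φ ∧ HasCompactSupport φ ∧ deriv φ = ψ := by
  obtain ⟨b, -, hsub⟩ := exists_tsupport_subset_Ioo hψc
  have hzero : ∀ x, x ∉ Set.Ioo (-b) b → ψ x = 0 := fun x hx =>
    image_eq_zero_of_notMem_tsupport fun h => hx (hsub h)
  have hd : ∀ x, HasDerivAt (fun x => ∫ t in (-b)..x, ψ t) (ψ x) x := fun x =>
    (hψ.continuous.integral_hasStrictDerivAt _ _).hasDerivAt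
  have hderiv : deriv (fun x => ∫ t in (-b)..x, ψ t) = ψ := funext fun x => (hd x).deriv
  refine ⟨fun x => ∫ t in (-b)..x, ψ t, ?_, ?_, hderiv⟩
  · rw [contDiff_infty_iff_deriv, hderiv]
    exact ⟨fun x => (hd x).differentiableAt, hψ⟩
  · refine HasCompactSupport.intro (isCompact_Icc (a := -b) (b := b)) fun x hx => ?_
    rcases lt_or_ge x (-b) with hlt | hge
    · rw [intervalIntegral.integral_symm, neg_eq_zero, intervalIntegral.integral_of_le hlt.le]
      exact setIntegral_eq_zero_of_forall_eq_zero fun t ht => hzero t fun h => ht.2.not_gt h.1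
    · have hbx : b < x := not_le.mp fun h => hx ⟨hge, h⟩
      rw [intervalIntegral.integral_eq_integral_of_support_subset, hψ0]
      intro t ht
      have htb := not_not.mp (mt (hzero t) ht)
      exact ⟨htb.1, (htb.2.trans hbx).le⟩

-- The fundamental lemma of the calculus of variations of du Bois-Reymond.
theorem exists_ae_eq_const_of_integral_deriv_smul_eq_zero [CompleteSpace E] {h : ℝ → E}
    (hh : LocallyIntegrable h)
    (hzero : ∀ φ : ℝ → ℝ, ContDiff ℝ ∞ φ → HasCompactSupport φ → ∫ x, deriv φ x • h x = 0) :
    ∃ c : E, ∀ᵐ x, h x = c := by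
  let B : ContDiffBump (0 : ℝ) := ⟨1, 2, one_pos, one_lt_two⟩
  let ρ : ℝ → ℝ := B.normed volume
  have hρ : ContDiff ℝ ∞ ρ := B.contDiff_normed
  have hρc : HasCompactSupport ρ := B.hasCompactSupport_normed
  refine ⟨∫ x, ρ x • h x, ae_eq_of_integral_contDiff_smul_eq hh (locallyIntegrable_const _)
    fun ψ hψ hψc => ?_⟩
  have hψi : Integrable ψ := hψ.continuous.integrable_of_hasCompactSupport hψc
  have hρi : Integrable ρ := hρ.continuous.integrable_of_hasCompactSupport hρc
  obtain ⟨φ, hφ, hφc, hφψ⟩ := exists_testFunction_deriv_eq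
    (ψ := fun x => ψ x - (∫ y, ψ y) * ρ x) (hψ.sub (contDiff_const.mul hρ))
    (hψc.sub hρc.mul_left) (by
      rw [integral_sub hψi (hρi.const_mul _), integral_const_mul, B.integral_normed, mul_one,
        sub_self])
  have hφh := hzero φ hφ hφc
  simp_rw [hφψ, sub_smul, mul_smul] at hφh
  rwa [integral_sub (hh.integrable_smul_left_of_hasCompactSupport hψ.continuous hψc)
      ((hh.integrable_smul_left_of_hasCompactSupport hρ.continuous hρc).fun_smul _),
    integral_smul, sub_eq_zero, ← integral_smul_const] at hφh

theorem integral_deriv_mul_primitive {g : ℝ → ℝ} (hg : LocallyIntegrable g) {φ : ℝ → ℝ}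
    (hφ : ContDiff ℝ ∞ φ) (hφc : HasCompactSupport φ) :
    ∫ x, deriv φ x * ∫ t in (0 : ℝ)..x, g t = -∫ x, φ x * g x := by
  obtain ⟨b, hb, hsub⟩ := exists_tsupport_subset_Ioo hφc
  have hsupp : Function.support φ ⊆ Set.Ioc (-b) b :=
    (subset_tsupport φ).trans (hsub.trans Set.Ioo_subset_Ioc_self)
  have hsupp' : Function.support (deriv φ) ⊆ Set.Ioc (-b) b :=
    (subset_tsupport _).trans
      ((tsupport_deriv_subset).trans (hsub.trans Set.Ioo_subset_Ioc_self))
  have hφb : φ b = 0 ∧ φ (-b) = 0 :=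
    ⟨image_eq_zero_of_notMem_tsupport fun h => (hsub h).2.false,
      image_eq_zero_of_notMem_tsupport fun h => (hsub h).1.false⟩
  have hgi : IntervalIntegrable g volume (-b) b :=
    (hg.integrableOn_isCompact isCompact_uIcc).intervalIntegrable
  have hmem : (0 : ℝ) ∈ Set.uIcc (-b) b := by
    rw [Set.uIcc_of_le (by linarith)]; constructor <;> linarith
  have hparts := (hgi.absolutelyContinuousOnInterval_intervalIntegral hmem)
    |>.integral_mul_deriv_eq_deriv_mul
      (hφ.of_le (by simp)).contDiffOn.absolutelyContinuousOnInterval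
  have hderiv : ∫ x in (-b)..b, deriv (fun x => ∫ t in (0 : ℝ)..x, g t) x * φ x
      = ∫ x in (-b)..b, φ x * g x := by
    refine intervalIntegral.integral_congr_ae ?_
    filter_upwards [hgi.ae_hasDerivAt_integral] with x hx hxm
    rw [(hx (Set.uIoc_subset_uIcc hxm) 0 hmem).deriv, mul_comm]
  rw [hderiv, hφb.1, hφb.2, mul_zero, mul_zero, sub_zero, zero_sub] at hparts
  rw [← intervalIntegral.integral_eq_integral_of_support_subset
      ((Function.support_mul_subset_left _ _).trans hsupp'),
    ← intervalIntegral.integral_eq_integral_of_support_subset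
      ((Function.support_mul_subset_left _ _).trans hsupp), ← hparts]
  simp_rw [mul_comm]

theorem integral_deriv_smul_primitive [CompleteSpace E] {g : ℝ → E} (hg : LocallyIntegrable g)
    {φ : ℝ → ℝ} (hφ : ContDiff ℝ ∞ φ) (hφc : HasCompactSupport φ) :
    ∫ x, deriv φ x • ∫ t in (0 : ℝ)..x, g t = -∫ x, φ x • g x := by
  have hgi : ∀ a b, IntervalIntegrable g volume a b := fun a b =>
    (hg.integrableOn_isCompact isCompact_uIcc).intervalIntegrable
  have hG : LocallyIntegrable fun x => ∫ t in (0 : ℝ)..x, g t :=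
    (intervalIntegral.continuous_primitive hgi 0).locallyIntegrable
  refine (SeparatingDual.eq_iff_forall_dual_eq (R := ℝ)).mpr fun T => ?_
  have hTg : LocallyIntegrable fun x => T (g x) := fun x =>
    (hg x).imp fun _ h => ⟨h.1, T.integrable_comp h.2⟩
  rw [map_neg, ← T.integral_comp_comm (hg.integrable_smul_left_of_hasCompactSupport
      hφ.continuous hφc), ← T.integral_comp_comm (hG.integrable_smul_left_of_hasCompactSupport
      (contDiff_deriv_of_contDiff hφ).continuous hφc.deriv)]
  simp_rw [map_smul, smul_eq_mul, ← T.intervalIntegral_comp_comm (hgi _ _)]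
  exact integral_deriv_mul_primitive hTg hφ hφc

theorem HasWeakDeriv.exists_primitive {f g : ℝ → ℂ} (hf : LocallyIntegrable f)
    (hg : LocallyIntegrable g) (hfg : HasWeakDeriv f g) :
    ∃ F : ℝ → ℂ, F =ᵐ[volume] f ∧ ∀ x y, F y - F x = ∫ t in x..y, g t := by
  have hgi : ∀ a b, IntervalIntegrable g volume a b := fun a b =>
    (hg.integrableOn_isCompact isCompact_uIcc).intervalIntegrable
  have hG : LocallyIntegrable fun x => ∫ t in (0 : ℝ)..x, g t :=
    (intervalIntegral.continuous_primitive hgi 0).locallyIntegrable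
  obtain ⟨c, hc⟩ := exists_ae_eq_const_of_integral_deriv_smul_eq_zero (hf.sub hG)
    fun φ hφ hφc => by
      have hφfg := hfg (fun x => (φ x : ℂ)) (Complex.ofRealCLM.contDiff.comp hφ)
        (hφc.comp_left Complex.ofReal_zero)
      simp_rw [((hφ.differentiable (by simp) _).hasDerivAt.ofReal_comp).deriv,
        ← Complex.real_smul] at hφfg
      have hφ' := (contDiff_deriv_of_contDiff hφ).continuous
      simp_rw [Pi.sub_apply, smul_sub]
      rw [integral_sub (hf.integrable_smul_left_of_hasCompactSupport hφ' hφc.deriv)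
        (hG.integrable_smul_left_of_hasCompactSupport hφ' hφc.deriv), hφfg,
        integral_deriv_smul_primitive hg hφ hφc, sub_self]
  refine ⟨fun x => c + ∫ t in (0 : ℝ)..x, g t, ?_, fun x y => ?_⟩
  · filter_upwards [hc] with x hx
    rw [← hx, Pi.sub_apply, sub_add_cancel]
  · rw [add_sub_add_left_eq_sub,
      intervalIntegral.integral_interval_sub_left (hgi _ _) (hgi _ _)]

end WeakDerivative

theorem integrable_testFunction_mul {φ : ℝ → ℂ} (hφ : Continuous φ) (hφc : HasCompactSupport φ)
    {f : ℝ → ℂ} (hf : LocallyIntegrable f) : Integrable fun x => φ x * f x :=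
  hf.integrable_smul_left_of_hasCompactSupport hφ hφc

namespace HasWeakDeriv

variable {f g f₁ g₁ : ℝ → ℂ}

theorem congr (h : HasWeakDeriv f g) (hf : f₁ =ᵐ[volume] f) (hg : g₁ =ᵐ[volume] g) :
    HasWeakDeriv f₁ g₁ := fun φ hφ hφc => by
  have hl : ∫ x, deriv φ x * f₁ x = ∫ x, deriv φ x * f x :=
    integral_congr_ae (by filter_upwards [hf] with x hx; rw [hx])
  have hr : ∫ x, φ x * g₁ x = ∫ x, φ x * g x :=
    integral_congr_ae (by filter_upwards [hg] with x hx; rw [hx])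
  rw [hl, hr, h φ hφ hφc]

theorem add (h : HasWeakDeriv f g) (h₁ : HasWeakDeriv f₁ g₁)
    (hf : LocallyIntegrable f) (hg : LocallyIntegrable g)
    (hf₁ : LocallyIntegrable f₁) (hg₁ : LocallyIntegrable g₁) :
    HasWeakDeriv (f + f₁) (g + g₁) := fun φ hφ hφc => by
  have hφ' := (contDiff_deriv_of_contDiff hφ).continuous
  simp only [Pi.add_apply, mul_add]
  rw [integral_add (integrable_testFunction_mul hφ' hφc.deriv hf)
      (integrable_testFunction_mul hφ' hφc.deriv hf₁),
    integral_add (integrable_testFunction_mul hφ.continuous hφc hg)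
      (integrable_testFunction_mul hφ.continuous hφc hg₁), neg_add, h φ hφ hφc, h₁ φ hφ hφc]

theorem const_smul (h : HasWeakDeriv f g) (c : ℂ) : HasWeakDeriv (c • f) (c • g) :=
  fun φ hφ hφc => by
  simp only [Pi.smul_apply, smul_eq_mul, mul_left_comm _ c]
  rw [integral_const_mul, integral_const_mul, h φ hφ hφc, mul_neg]

theorem contDiff_mul (h : HasWeakDeriv f g) (hf : LocallyIntegrable f) (hg : LocallyIntegrable g)
    {χ : ℝ → ℂ} (hχ : ContDiff ℝ ∞ χ) :
    HasWeakDeriv (fun x => χ x * f x) fun x => deriv χ x * f x + χ x * g x := fun φ hφ hφc => by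
  have hχ' := contDiff_deriv_of_contDiff hχ
  have hφ' := contDiff_deriv_of_contDiff hφ
  have hleibniz : ∀ x, deriv (fun x => χ x * φ x) x = deriv χ x * φ x + χ x * deriv φ x :=
    fun x => ((hχ.differentiable (by simp) x).hasDerivAt.mul
      (hφ.differentiable (by simp) x).hasDerivAt).deriv
  have hχ'φf := integrable_testFunction_mul (hχ'.mul hφ).continuous hφc.mul_left hf
  have hχφ'f := integrable_testFunction_mul (hχ.mul hφ').continuous hφc.deriv.mul_left hf
  have hχφg := integrable_testFunction_mul (hχ.mul hφ).continuous hφc.mul_left hg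
  have htest := h (fun x => χ x * φ x) (hχ.mul hφ) hφc.mul_left
  simp_rw [hleibniz, add_mul] at htest
  rw [integral_add hχ'φf hχφ'f] at htest
  calc ∫ x, deriv φ x * (χ x * f x) = ∫ x, χ x * deriv φ x * f x := by
        congr 1 with x; ring
    _ = -((∫ x, deriv χ x * φ x * f x) + ∫ x, χ x * φ x * g x) := by linear_combination htest
    _ = -∫ x, φ x * (deriv χ x * f x + χ x * g x) := by
        rw [← integral_add hχ'φf hχφg]
        congr 2 with x; ring

end HasWeakDeriv

/-- The Hilbert space `L²(ℝ) ⊕ L²(ℝ)`. The quadratic form of `-∂ₓ² + V` at `f` is the squared norm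
of the vector `(f', √V f)` of this space. -/
abbrev EnergySpace : Type := WithLp 2 (L2 × L2)

theorem locallyIntegrable_coe (f : L2) : LocallyIntegrable (f : ℝ → ℂ) :=
  (Lp.memLp f).locallyIntegrable one_le_two

/-- The graph of `f ↦ (f', √V f)` on the form domain of `-∂ₓ² + V`. -/
def energyGraph (V : ℝ → ℝ) : Submodule ℂ (L2 × EnergySpace) where
  carrier := {p | HasWeakDeriv p.1 p.2.fst ∧
    (p.2.snd : ℝ → ℂ) =ᵐ[volume] fun x => (√(V x) : ℂ) * p.1 x}
  zero_mem' := by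
    have hzero : HasWeakDeriv 0 0 := fun φ _ _ => by simp
    refine ⟨hzero.congr (Lp.coeFn_zero _ _ _) (Lp.coeFn_zero _ _ _), ?_⟩
    filter_upwards [Lp.coeFn_zero ℂ 2 (volume : Measure ℝ)] with x _
    simp
  add_mem' := by
    rintro ⟨f, e⟩ ⟨f₁, e₁⟩ ⟨hf, he⟩ ⟨hf₁, he₁⟩
    refine ⟨(hf.add hf₁ (locallyIntegrable_coe _) (locallyIntegrable_coe _)
      (locallyIntegrable_coe _) (locallyIntegrable_coe _)).congr
      (Lp.coeFn_add _ _) (Lp.coeFn_add _ _), ?_⟩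
    filter_upwards [he, he₁, Lp.coeFn_add f f₁, Lp.coeFn_add e.snd e₁.snd] with x hx hx₁ hf he
    simp only [Prod.mk_add_mk, WithLp.add_snd]
    rw [he, hf, Pi.add_apply, Pi.add_apply, hx, hx₁, mul_add]
  smul_mem' := by
    rintro c ⟨f, e⟩ ⟨hf, he⟩
    refine ⟨(hf.const_smul c).congr (Lp.coeFn_smul _ _) (Lp.coeFn_smul _ _), ?_⟩
    filter_upwards [he, Lp.coeFn_smul c f, Lp.coeFn_smul c e.snd] with x hx hf he
    simp only [Prod.smul_mk, WithLp.smul_snd]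
    rw [he, hf, Pi.smul_apply, Pi.smul_apply, hx, smul_eq_mul, smul_eq_mul, mul_left_comm]

section EnergyGraph

variable {V : ℝ → ℝ}

theorem exists_mem_energyGraph_mul {p : L2 × EnergySpace} (hp : p ∈ energyGraph V) {χ : ℝ → ℂ}
    (hχ : ContDiff ℝ ∞ χ) (hχc : HasCompactSupport χ) :
    ∃ q ∈ energyGraph V, (q.1 : ℝ → ℂ) =ᵐ[volume] fun x => χ x * p.1 x := by
  have hmul : ∀ {χ : ℝ → ℂ}, Continuous χ → HasCompactSupport χ → ∀ f : L2,
      MemLp (fun x => χ x * f x) 2 := fun hχ hχc f =>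
    (Lp.memLp f).mul' (hχ.memLp_top_of_hasCompactSupport hχc volume)
  have hf := hmul hχ.continuous hχc p.1
  have hf' := (hmul (contDiff_deriv_of_contDiff hχ).continuous hχc.deriv p.1).add
    (hmul hχ.continuous hχc p.2.fst)
  have hk := hmul hχ.continuous hχc p.2.snd
  refine ⟨(hf.toLp _, WithLp.toLp 2 (hf'.toLp _, hk.toLp _)), ⟨?_, ?_⟩, hf.coeFn_toLp⟩
  · exact (hp.1.contDiff_mul (locallyIntegrable_coe _) (locallyIntegrable_coe _) hχ).congr
      hf.coeFn_toLp hf'.coeFn_toLp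
  · filter_upwards [hf.coeFn_toLp, hk.coeFn_toLp, hp.2] with x hfx hkx hpx
    change hk.toLp _ x = _ * hf.toLp _ x
    rw [hfx, hkx, hpx, mul_left_comm]

theorem sq_norm_sqrt_mul {a : ℝ} (ha : 0 ≤ a) (z : ℂ) : ‖(√a : ℂ) * z‖ ^ 2 = a * ‖z‖ ^ 2 := by
  rw [norm_mul, mul_pow, Complex.norm_real, Real.norm_eq_abs, sq_abs, Real.sq_sqrt ha]

theorem MemFormDomain.exists_mem_energyGraph (hVm : AEMeasurable V volume)
    (hV0 : ∀ᵐ x, 0 ≤ V x) {f f' : L2} (h : MemFormDomain V f f') :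
    ∃ e : EnergySpace, e.fst = f' ∧ (f, e) ∈ energyGraph V := by
  have hm : AEStronglyMeasurable (fun x => (√(V x) : ℂ) * f x) volume :=
    (Complex.measurable_ofReal.comp_aemeasurable hVm.sqrt).aestronglyMeasurable.mul
      (Lp.aestronglyMeasurable f)
  have hk : MemLp (fun x => (√(V x) : ℂ) * f x) 2 volume := by
    rw [memLp_two_iff_integrable_sq_norm hm]
    refine h.potential.congr ?_
    filter_upwards [hV0] with x hx using (sq_norm_sqrt_mul hx _).symm
  exact ⟨WithLp.toLp 2 (f', hk.toLp _), rfl, h.weakDeriv, hk.coeFn_toLp⟩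

theorem memFormDomain_of_mem_energyGraph (hV0 : ∀ᵐ x, 0 ≤ V x) {p : L2 × EnergySpace}
    (hp : p ∈ energyGraph V) : MemFormDomain V p.1 p.2.fst := by
  refine ⟨hp.1, ((memLp_two_iff_integrable_sq_norm (Lp.aestronglyMeasurable p.2.snd)).mp
    (Lp.memLp p.2.snd)).congr ?_⟩
  filter_upwards [hV0, hp.2] with x hx hk
  rw [hk, sq_norm_sqrt_mul hx]

theorem inner_L2_eq_integral (f g : L2) : ⟪f, g⟫_ℂ = ∫ x, conj (f x) * g x := by
  rw [L2.inner_def]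
  simp_rw [RCLike.inner_apply']

theorem inner_snd_eq_form (hV0 : ∀ᵐ x, 0 ≤ V x) {p q : L2 × EnergySpace}
    (hp : p ∈ energyGraph V) (hq : q ∈ energyGraph V) :
    ⟪p.2, q.2⟫_ℂ = (∫ x, conj (p.2.fst x) * q.2.fst x) +
      ∫ x, (V x : ℂ) * (conj (p.1 x) * q.1 x) := by
  have hsnd : ⟪p.2.snd, q.2.snd⟫_ℂ = ∫ x, (V x : ℂ) * (conj (p.1 x) * q.1 x) := by
    rw [inner_L2_eq_integral]
    refine integral_congr_ae ?_
    filter_upwards [hV0, hp.2, hq.2] with x hx hpx hqx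
    have hsqrt : (V x : ℂ) = (√(V x) : ℂ) * (√(V x) : ℂ) := by
      rw [← Complex.ofReal_mul, Real.mul_self_sqrt hx]
    rw [hpx, hqx, map_mul, Complex.conj_ofReal, hsqrt]
    ring
  rw [← hsnd, ← inner_L2_eq_integral, WithLp.prod_inner_apply]
  rfl

theorem SchrodingerApply.exists_mem_energyGraph (hVm : AEMeasurable V volume)
    (hV0 : ∀ᵐ x, 0 ≤ V x) {f g : L2} (h : SchrodingerApply V f g) :
    ∃ e : EnergySpace, (f, e) ∈ energyGraph V ∧
      ∀ p ∈ energyGraph V, ⟪p.2, e⟫_ℂ = ⟪p.1, g⟫_ℂ := by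
  obtain ⟨f', hf, hform⟩ := h
  obtain ⟨e, rfl, he⟩ := hf.exists_mem_energyGraph hVm hV0
  refine ⟨e, he, fun p hp => ?_⟩
  rw [inner_snd_eq_form hV0 hp he, inner_L2_eq_integral,
    hform p.1 p.2.fst (memFormDomain_of_mem_energyGraph hV0 hp)]

end EnergyGraph

/-- The weak form of the eigenvalue equations `h uₙ = λₙ uₙ`, where `eₙ = (uₙ', √V uₙ)`. -/
structure IsEigenSystem (V : ℝ → ℝ) (lam : ℕ → ℝ) (u : HilbertBasis ℕ ℂ L2)
    (e : ℕ → EnergySpace) : Prop where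
  mem : ∀ n, (u n, e n) ∈ energyGraph V
  inner_eq : ∀ n, ∀ p ∈ energyGraph V, ⟪p.2, e n⟫_ℂ = lam n * ⟪p.1, u n⟫_ℂ

theorem IsSpectralDecomposition.exists_isEigenSystem {V : ℝ → ℝ} (hVm : AEMeasurable V volume)
    (hV0 : ∀ᵐ x, 0 ≤ V x) {lam : ℕ → ℝ} {u : HilbertBasis ℕ ℂ L2}
    (h : IsSpectralDecomposition V lam u) : ∃ e, IsEigenSystem V lam u e := by
  choose e hmem hinner using fun n => (h n).exists_mem_energyGraph hVm hV0
  refine ⟨e, hmem, fun n p hp => ?_⟩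
  rw [hinner n p hp, inner_smul_right]

namespace IsEigenSystem

variable {V : ℝ → ℝ} {lam : ℕ → ℝ} {u : HilbertBasis ℕ ℂ L2} {e : ℕ → EnergySpace}

theorem sum_mem (h : IsEigenSystem V lam u e) (t : Finset ℕ) (c : ℕ → ℂ) :
    (∑ n ∈ t, c n • u n, ∑ n ∈ t, c n • e n) ∈ energyGraph V := by
  have hsum : (∑ n ∈ t, c n • u n, ∑ n ∈ t, c n • e n) = ∑ n ∈ t, c n • (u n, e n) := by
    simp [Prod.ext_iff, Prod.fst_sum, Prod.snd_sum]
  rw [hsum]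
  exact Submodule.sum_mem _ fun n _ => Submodule.smul_mem _ _ (h.mem n)

theorem inner_sum (h : IsEigenSystem V lam u e) (t : Finset ℕ) (c : ℕ → ℂ) {p : L2 × EnergySpace}
    (hp : p ∈ energyGraph V) :
    ⟪p.2, ∑ n ∈ t, c n • e n⟫_ℂ = ∑ n ∈ t, c n * (lam n * ⟪p.1, u n⟫_ℂ) := by
  rw [_root_.inner_sum]
  refine Finset.sum_congr rfl fun n _ => ?_
  rw [inner_smul_right, h.inner_eq n p hp]

theorem norm_sum_sq (h : IsEigenSystem V lam u e) (t : Finset ℕ) (c : ℕ → ℂ) :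
    ‖∑ n ∈ t, c n • e n‖ ^ 2 = ∑ n ∈ t, lam n * ‖c n‖ ^ 2 := by
  have hinner := h.inner_sum t c (h.sum_mem t c)
  rw [inner_self_eq_norm_sq_to_K] at hinner
  apply Complex.ofReal_injective
  push_cast
  refine hinner.trans (Finset.sum_congr rfl fun n hn => ?_)
  rw [u.orthonormal.inner_left_sum c hn, ← Complex.mul_conj']
  ring

theorem lam_pos (h : IsEigenSystem V lam u e) (hV : ∀ᵐ x, 0 < V x) (n : ℕ) : 0 < lam n := by
  have hlam : ‖e n‖ ^ 2 = lam n := by simpa using h.norm_sum_sq {n} fun _ => 1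
  suffices e n ≠ 0 by rw [← hlam]; positivity
  intro he
  have hu : u n = 0 := by
    refine Lp.ext ?_
    filter_upwards [(h.mem n).2, hV, Lp.coeFn_zero ℂ 2 (volume : Measure ℝ)] with x hx hVx hzero
    have hsqrt : (√(V x) : ℂ) ≠ 0 := Complex.ofReal_ne_zero.mpr (Real.sqrt_pos.mpr hVx).ne'
    simp only [he] at hx
    change (0 : L2) x = _ at hx
    rw [hzero, Pi.zero_apply] at hx ⊢
    exact (mul_eq_zero.mp hx.symm).resolve_left hsqrt
  exact u.orthonormal.ne_zero n hu

-- Bessel's inequality for the `eₙ`, which are orthogonal in the energy space.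
theorem norm_sub_sum_le (h : IsEigenSystem V lam u e) (t : Finset ℕ) {p : L2 × EnergySpace}
    (hp : p ∈ energyGraph V) :
    ‖p.2 - ∑ n ∈ t, ⟪u n, p.1⟫_ℂ • e n‖ ≤ ‖p.2‖ := by
  have hmem := Submodule.sub_mem _ hp (h.sum_mem t fun n => ⟪u n, p.1⟫_ℂ)
  have horth : ⟪p.2 - ∑ n ∈ t, ⟪u n, p.1⟫_ℂ • e n, ∑ n ∈ t, ⟪u n, p.1⟫_ℂ • e n⟫_ℂ = 0 := by
    refine (h.inner_sum t _ hmem).trans (Finset.sum_eq_zero fun n hn => ?_)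
    simp only [Prod.fst_sub, inner_sub_left,
      u.orthonormal.inner_left_sum (fun n => ⟪u n, p.1⟫_ℂ) hn, inner_conj_symm, sub_self, mul_zero]
  have hpyth := norm_add_sq_eq_norm_sq_add_norm_sq_of_inner_eq_zero _ _ horth
  rw [sub_add_cancel] at hpyth
  refine abs_le_of_sq_le_sq' ?_ (norm_nonneg _) |>.2
  nlinarith [norm_nonneg (∑ n ∈ t, ⟪u n, p.1⟫_ℂ • e n)]

end IsEigenSystem

section PointwiseBound

theorem sq_norm_intervalIntegral_le (g : L2) (x y : ℝ) :
    ‖∫ t in x..y, g t‖ ^ 2 ≤ |y - x| * ‖g‖ ^ 2 := by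
  have hfin : volume (Set.uIoc x y) ≠ ⊤ := by simp [Set.uIoc]
  have hinner : ‖∫ t in x..y, g t‖
      = ‖⟪indicatorConstLp 2 measurableSet_uIoc hfin (1 : ℂ), g⟫_ℂ‖ := by
    rw [L2.inner_indicatorConstLp_one, intervalIntegral.norm_intervalIntegral_eq]
  have hnorm : ‖indicatorConstLp 2 measurableSet_uIoc hfin (1 : ℂ)‖ ^ 2 = |y - x| := by
    rw [norm_indicatorConstLp two_ne_zero ENNReal.ofNat_ne_top]
    simp only [norm_one, one_mul, ENNReal.toReal_ofNat, Measure.real, Real.volume_uIoc]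
    rw [ENNReal.toReal_ofReal (abs_nonneg _), ← Real.sqrt_eq_rpow, Real.sq_sqrt (abs_nonneg _)]
  rw [hinner, ← hnorm, ← mul_pow]
  gcongr
  exact norm_inner_le_norm _ _

theorem integrable_sq_norm_coe (k : L2) : Integrable fun t => ‖k t‖ ^ 2 :=
  (memLp_two_iff_integrable_sq_norm (Lp.aestronglyMeasurable k)).mp (Lp.memLp k)

theorem integral_sq_norm_coe (k : L2) : ∫ t, ‖k t‖ ^ 2 = ‖k‖ ^ 2 := by
  have hinner := @inner_self_eq_norm_sq_to_K ℂ L2 _ _ _ k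
  rw [L2.inner_def] at hinner
  simp_rw [inner_self_eq_norm_sq_to_K] at hinner
  apply Complex.ofReal_injective
  rw [← integral_complex_ofReal]
  push_cast
  exact hinner

-- Average `‖F x‖² ≤ 2 ‖F t‖² + 2 ‖F t - F x‖²` over `t` in the interval.
theorem mul_sq_norm_le_of_sq_norm_le_on_interval {F : ℝ → ℂ} {g k : L2}
    (hF : ∀ x y, F y - F x = ∫ t in x..y, g t) {x a δ κ : ℝ} (hδ : 0 ≤ δ) (hκ : 0 ≤ κ)
    (hdist : ∀ t ∈ Set.Ioc a (a + δ), |t - x| ≤ 2 * δ)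
    (hFk : ∀ᵐ t, t ∈ Set.Ioc a (a + δ) → ‖F t‖ ^ 2 ≤ κ * ‖k t‖ ^ 2) :
    δ * ‖F x‖ ^ 2 ≤ 2 * κ * ‖k‖ ^ 2 + 4 * δ ^ 2 * ‖g‖ ^ 2 := by
  have hpt : ∀ᵐ t ∂(volume.restrict (Set.Ioc a (a + δ))),
      ‖F x‖ ^ 2 ≤ 2 * κ * ‖k t‖ ^ 2 + 4 * δ * ‖g‖ ^ 2 := by
    rw [ae_restrict_iff' measurableSet_Ioc]
    filter_upwards [hFk] with t hFt ht
    have hincr : ‖F t - F x‖ ^ 2 ≤ 2 * δ * ‖g‖ ^ 2 := by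
      rw [hF x t]
      exact (sq_norm_intervalIntegral_le _ _ _).trans (by gcongr; exact hdist t ht)
    have htri : ‖F x‖ ≤ ‖F t‖ + ‖F t - F x‖ := by simpa using norm_sub_le (F t) (F t - F x)
    nlinarith [hFt ht, norm_nonneg (F x), sq_nonneg (‖F t‖ - ‖F t - F x‖)]
  have hconst : ∀ c : ℝ, IntegrableOn (fun _ : ℝ => c) (Set.Ioc a (a + δ)) := fun c =>
    integrableOn_const (by simp)
  have hk := ((integrable_sq_norm_coe k).const_mul (2 * κ)).integrableOn (s := Set.Ioc a (a + δ))
  have hmono := integral_mono_ae (hconst _) (hk.add (hconst _)) hpt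
  rw [integral_add' hk (hconst _), integral_const_mul] at hmono
  simp only [setIntegral_const, Real.volume_real_Ioc, add_sub_cancel_left, max_eq_left hδ,
    smul_eq_mul] at hmono
  have hset : ∫ t in Set.Ioc a (a + δ), ‖k t‖ ^ 2 ≤ ‖k‖ ^ 2 := by
    rw [← integral_sq_norm_coe]
    exact setIntegral_le_integral (integrable_sq_norm_coe k) (.of_forall fun t => by positivity)
  nlinarith [mul_le_mul_of_nonneg_left hset hκ]

theorem sq_norm_le_mul_sq_norm_sqrt_mul {v s C m t : ℝ} (hs : 0 ≤ s) (hC : 0 < C) (hm : 0 < m)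
    (hmt : m ≤ |t|) (hv : C⁻¹ * |t| ^ s ≤ v) (z : ℂ) :
    ‖z‖ ^ 2 ≤ C * m ^ (-s) * ‖(√v : ℂ) * z‖ ^ 2 := by
  have hms : 0 < m ^ s := Real.rpow_pos_of_pos hm s
  have hmv : m ^ s ≤ C * v := calc
    m ^ s ≤ |t| ^ s := Real.rpow_le_rpow hm.le hmt hs
    _ = C * (C⁻¹ * |t| ^ s) := (mul_inv_cancel_left₀ hC.ne' _).symm
    _ ≤ C * v := by gcongr
  have hv0 : 0 ≤ v := (pos_of_mul_pos_right (hms.trans_le hmv) hC.le).le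
  calc ‖z‖ ^ 2 = (m ^ s)⁻¹ * (m ^ s * ‖z‖ ^ 2) := (inv_mul_cancel_left₀ hms.ne' _).symm
    _ ≤ (m ^ s)⁻¹ * (C * v * ‖z‖ ^ 2) := by gcongr
    _ = C * m ^ (-s) * ‖(√v : ℂ) * z‖ ^ 2 := by
        rw [sq_norm_sqrt_mul hv0, Real.rpow_neg hm.le]
        ring

theorem exists_interval_far_from_zero {x m δ : ℝ} (hxm : |x| ≤ m) (hmx : m - |x| ≤ δ) :
    ∃ a, ∀ t ∈ Set.Ioc a (a + δ), m ≤ |t| ∧ |t - x| ≤ 2 * δ := by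
  rcases le_total 0 x with hx | hx
  · rw [abs_of_nonneg hx] at hmx hxm
    refine ⟨m, fun t ht => ?_⟩
    rw [abs_of_nonneg (by linarith [ht.1]), abs_of_nonneg (by linarith [ht.1])]
    exact ⟨ht.1.le, by linarith [ht.2]⟩
  · rw [abs_of_nonpos hx] at hmx hxm
    refine ⟨-m - δ, fun t ht => ?_⟩
    rw [abs_of_nonpos (by linarith [ht.2]), abs_of_nonpos (by linarith [ht.2])]
    exact ⟨by linarith [ht.2], by linarith [ht.1]⟩

/-- The function `x ↦ (2 C + 4) max(1, |x|) ^ (-s / 2)`, which dominates `|f(x)|²` for every `f` of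
unit energy. The exponent balances the two terms of the averaging argument on an interval of length
`|x| ^ (-s / 2)`. -/
def envelope (s C x : ℝ) : ℝ := (2 * C + 4) * max 1 |x| ^ (-(s / 2))

theorem envelope_pos {s C : ℝ} (hC : 0 < C) (x : ℝ) : 0 < envelope s C x := by
  unfold envelope
  positivity

theorem continuous_envelope (s C : ℝ) : Continuous (envelope s C) := by
  unfold envelope
  exact continuous_const.mul (Continuous.rpow_const (by fun_prop) fun x => .inl (by positivity))

theorem integrable_max_one_abs_rpow_neg {a : ℝ} (ha : 1 < a) :
    Integrable fun x : ℝ => max 1 |x| ^ (-a) := by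
  have hone : Integrable fun x : ℝ => (1 + ‖x‖) ^ (-a) := integrable_one_add_norm (by simpa)
  refine (hone.const_mul (2 ^ a)).mono' ?_ (.of_forall fun x => ?_)
  · exact (Continuous.rpow_const (by fun_prop) fun x => .inl (by positivity)).aestronglyMeasurable
  · have hhalf : (1 + |x|) / 2 ≤ max 1 |x| := by
      linarith [le_max_left 1 |x|, le_max_right 1 |x|]
    rw [Real.norm_of_nonneg (by positivity)]
    refine (Real.rpow_le_rpow_of_nonpos (by positivity) hhalf (by linarith)).trans_eq ?_
    rw [Real.div_rpow (by positivity) zero_le_two, Real.rpow_neg zero_le_two, div_inv_eq_mul,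
      mul_comm, Real.norm_eq_abs]

theorem integrable_envelope_rpow {s C p : ℝ} (hC : 0 < C) (hp : 1 < s / 2 * p) :
    Integrable fun x => envelope s C x ^ p := by
  refine ((integrable_max_one_abs_rpow_neg hp).const_mul ((2 * C + 4) ^ p)).congr
    (.of_forall fun x => ?_)
  simp only [envelope]
  rw [Real.mul_rpow (by positivity) (by positivity), ← Real.rpow_mul (by positivity), neg_mul]

theorem memLp_envelope {s C : ℝ} (hs : 0 < s) (hC : 0 < C) {p : ℝ≥0∞}
    (hp : ENNReal.ofReal (2 / s) < p) : MemLp (envelope s C) p := by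
  have hm := (continuous_envelope s C).aestronglyMeasurable (μ := (volume : Measure ℝ))
  rcases eq_or_ne p ⊤ with rfl | hp_top
  · refine memLp_top_of_bound hm (2 * C + 4) (.of_forall fun x => ?_)
    rw [Real.norm_of_nonneg (envelope_pos hC x).le]
    exact mul_le_of_le_one_right (by positivity)
      (Real.rpow_le_one_of_one_le_of_nonpos (le_max_left _ _) (by linarith))
  · rw [← integrable_norm_rpow_iff hm hp.ne_bot hp_top]
    simp_rw [Real.norm_of_nonneg (envelope_pos hC _).le]
    refine integrable_envelope_rpow hC ?_
    have := (ENNReal.ofReal_lt_iff_lt_toReal (by positivity) hp_top).mp hp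
    rw [div_lt_iff₀ hs] at this
    linarith

variable {V : ℝ → ℝ} {s C : ℝ}

theorem sq_norm_le_envelope_mul (hs : 0 ≤ s) (hC : 0 < C) (hV : ∀ᵐ x : ℝ, C⁻¹ * |x| ^ s ≤ V x)
    {F : ℝ → ℂ} {e : EnergySpace} (hF : ∀ x y, F y - F x = ∫ t in x..y, e.fst t)
    (hk : (e.snd : ℝ → ℂ) =ᵐ[volume] fun x => (√(V x) : ℂ) * F x) (x : ℝ) :
    ‖F x‖ ^ 2 ≤ envelope s C x * ‖e‖ ^ 2 := by
  set m := max 1 |x| with hm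
  have hm0 : 0 < m := by positivity
  set δ := m ^ (-(s / 2)) with hδ
  have hδ0 : 0 < δ := Real.rpow_pos_of_pos hm0 _
  have hδ2 : m ^ (-s) = δ * δ := by
    rw [hδ, ← Real.rpow_add hm0]; ring_nf
  have hmx : m - |x| ≤ δ := by
    rcases le_total 1 |x| with h | h
    · rw [hm, max_eq_right h, sub_self]; exact hδ0.le
    · rw [hδ, hm, max_eq_left h, Real.one_rpow]; linarith [abs_nonneg x]
  obtain ⟨a, ha⟩ := exists_interval_far_from_zero (le_max_right 1 |x|) hmx
  have havg : δ * ‖F x‖ ^ 2 ≤ 2 * (C * m ^ (-s)) * ‖e.snd‖ ^ 2 + 4 * δ ^ 2 * ‖e.fst‖ ^ 2 := by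
    refine mul_sq_norm_le_of_sq_norm_le_on_interval hF hδ0.le (by positivity)
      (fun t ht => (ha t ht).2) ?_
    filter_upwards [hV, hk] with t hVt hkt ht
    rw [hkt]
    exact sq_norm_le_mul_sq_norm_sqrt_mul hs hC hm0 (ha t ht).1 hVt _
  have hfst := mul_nonneg hC.le (sq_nonneg ‖e.fst‖)
  refine le_of_mul_le_mul_left ?_ hδ0
  calc δ * ‖F x‖ ^ 2 ≤ δ * (δ * (2 * C * ‖e.snd‖ ^ 2 + 4 * ‖e.fst‖ ^ 2)) := by
        rw [hδ2] at havg
        linarith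
    _ ≤ δ * (δ * ((2 * C + 4) * (‖e.fst‖ ^ 2 + ‖e.snd‖ ^ 2))) := by
        gcongr
        linarith [sq_nonneg ‖e.snd‖]
    _ = δ * (envelope s C x * ‖e‖ ^ 2) := by
        rw [envelope, WithLp.prod_norm_sq_eq_of_L2 e]
        ring

theorem exists_continuous_sq_norm_le_envelope_mul (hs : 0 ≤ s) (hC : 0 < C)
    (hV : ∀ᵐ x : ℝ, C⁻¹ * |x| ^ s ≤ V x) {p : L2 × EnergySpace} (hp : p ∈ energyGraph V) :
    ∃ F : ℝ → ℂ, Continuous F ∧ F =ᵐ[volume] p.1 ∧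
      ∀ x, ‖F x‖ ^ 2 ≤ envelope s C x * ‖p.2‖ ^ 2 := by
  obtain ⟨F, hFp, hF⟩ := hp.1.exists_primitive (locallyIntegrable_coe _) (locallyIntegrable_coe _)
  have hFc : Continuous fun x => F 0 + ∫ t in (0 : ℝ)..x, p.2.fst t :=
    continuous_const.add (intervalIntegral.continuous_primitive (fun a b =>
      ((locallyIntegrable_coe _).integrableOn_isCompact isCompact_uIcc).intervalIntegrable) 0)
  refine ⟨F, ?_, hFp, sq_norm_le_envelope_mul hs hC hV hF ?_⟩
  · simpa only [← hF, add_sub_cancel] using hFc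
  · filter_upwards [hp.2, hFp] with x hx hFx
    rw [hx, hFx]

end PointwiseBound

section GreenDiagonal

-- Test the hypothesis with `c i = conj (a i) / l i`.
theorem sum_sq_norm_div_le_of_forall_sq_norm_sum_le {ι : Type*} {t : Finset ι} {a : ι → ℂ}
    {l : ι → ℝ} (hl : ∀ i, 0 < l i) {K : ℝ} (hK : 0 ≤ K)
    (h : ∀ c : ι → ℂ, ‖∑ i ∈ t, c i * a i‖ ^ 2 ≤ K * ∑ i ∈ t, l i * ‖c i‖ ^ 2) :
    ∑ i ∈ t, ‖a i‖ ^ 2 / l i ≤ K := by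
  set G := ∑ i ∈ t, ‖a i‖ ^ 2 / l i with hG
  have hG0 : 0 ≤ G := Finset.sum_nonneg fun i _ => div_nonneg (sq_nonneg _) (hl i).le
  have hlin : ∑ i ∈ t, conj (a i) / l i * a i = (G : ℂ) := by
    rw [hG, Complex.ofReal_sum]
    refine Finset.sum_congr rfl fun i _ => ?_
    push_cast
    rw [← Complex.conj_mul']
    ring
  have hquad : ∑ i ∈ t, l i * ‖conj (a i) / l i‖ ^ 2 = G := by
    refine Finset.sum_congr rfl fun i _ => ?_
    rw [norm_div, RCLike.norm_conj, Complex.norm_real, Real.norm_of_nonneg (hl i).le]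
    have := (hl i).ne'
    field_simp
  have hsq := h fun i => conj (a i) / l i
  rw [hlin, hquad, Complex.norm_real, Real.norm_eq_abs, sq_abs, sq] at hsq
  rcases hG0.eq_or_lt with h0 | hpos
  · exact h0 ▸ hK
  · exact le_of_mul_le_mul_right hsq hpos

theorem coeFn_sum_smul {X : Type*} [MeasurableSpace X] {ν : Measure X} {p : ℝ≥0∞} (t : Finset ℕ)
    (c : ℕ → ℂ) (v : ℕ → Lp ℂ p ν) :
    (∑ n ∈ t, c n • v n : Lp ℂ p ν) =ᵐ[ν] fun x => ∑ n ∈ t, c n * v n x := by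
  filter_upwards [Lp.coeFn_fun_finsetSum t (fun n => c n • v n),
    ae_all_iff.mpr fun n => Lp.coeFn_smul (c n) (v n)] with x hsum hsmul
  rw [hsum]
  exact Finset.sum_congr rfl fun n _ => hsmul n

theorem measurable_greenDiag (lam : ℕ → ℝ) (u : HilbertBasis ℕ ℂ L2) :
    Measurable (greenDiag lam u) := by
  refine Measurable.tsum fun n => ?_
  have := (Lp.stronglyMeasurable (u n)).measurable
  fun_prop

namespace IsEigenSystem

variable {V : ℝ → ℝ} {lam : ℕ → ℝ} {u : HilbertBasis ℕ ℂ L2} {e : ℕ → EnergySpace} {s C : ℝ}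

theorem ae_sum_le_envelope (h : IsEigenSystem V lam u e) (hlam : ∀ n, 0 < lam n)
    (hs : 0 ≤ s) (hC : 0 < C) (hV : ∀ᵐ x : ℝ, C⁻¹ * |x| ^ s ≤ V x) :
    ∀ᵐ x, ∀ t : Finset ℕ, ∑ n ∈ t, ‖u n x‖ ^ 2 / lam n ≤ envelope s C x := by
  choose F hFc hFu _ using fun n => exists_continuous_sq_norm_le_envelope_mul hs hC hV (h.mem n)
  filter_upwards [ae_all_iff.mpr hFu] with x hx t
  simp_rw [← hx]
  refine sum_sq_norm_div_le_of_forall_sq_norm_sum_le hlam (envelope_pos hC x).le fun c => ?_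
  obtain ⟨G, hGc, hGu, hG⟩ := exists_continuous_sq_norm_le_envelope_mul hs hC hV (h.sum_mem t c)
  have hGF : G = fun y => ∑ n ∈ t, c n * F n y := by
    refine (hGc.ae_eq_iff_eq volume (by fun_prop)).mp ?_
    filter_upwards [hGu, coeFn_sum_smul t c (fun n => u n), ae_all_iff.mpr hFu] with y hy hsum hFy
    simp only [hy, hsum, hFy]
  rw [← h.norm_sum_sq t c, ← congrFun hGF x]
  exact hG x

theorem ae_greenDiag_le_envelope (h : IsEigenSystem V lam u e) (hlam : ∀ n, 0 < lam n)
    (hs : 0 ≤ s) (hC : 0 < C) (hV : ∀ᵐ x : ℝ, C⁻¹ * |x| ^ s ≤ V x) :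
    ∀ᵐ x, greenDiag lam u x ≤ ENNReal.ofReal (envelope s C x) := by
  filter_upwards [h.ae_sum_le_envelope hlam hs hC hV] with x hx
  rw [greenDiag, ENNReal.tsum_eq_iSup_sum]
  refine iSup_le fun t => ?_
  rw [← ENNReal.ofReal_sum_of_nonneg fun n _ => div_nonneg (sq_nonneg _) (hlam n).le]
  exact ENNReal.ofReal_le_ofReal (hx t)

theorem memLp_greenDiag (h : IsEigenSystem V lam u e) (hlam : ∀ n, 0 < lam n)
    (hs : 0 < s) (hC : 0 < C) (hV : ∀ᵐ x : ℝ, C⁻¹ * |x| ^ s ≤ V x) {p : ℝ≥0∞}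
    (hp : ENNReal.ofReal (2 / s) < p) : MemLp (greenDiag lam u) p := by
  refine ⟨(measurable_greenDiag lam u).aestronglyMeasurable,
    lt_of_le_of_lt (eLpNorm_mono_enorm_ae ?_) (memLp_envelope hs hC hp).2⟩
  filter_upwards [h.ae_greenDiag_le_envelope hlam hs.le hC hV] with x hx
  rwa [enorm_eq_self, Real.enorm_eq_ofReal (envelope_pos hC x).le]

end IsEigenSystem

end GreenDiagonal

section Coefficients

variable {V : ℝ → ℝ} {s C : ℝ}

theorem lintegral_rpow_add_le_of_le_mul {X : Type*} [MeasurableSpace X] {ν : Measure X}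
    {F K W : X → ℝ≥0∞} (hF : AEMeasurable F ν) (hK : AEMeasurable K ν) (hW : AEMeasurable W ν)
    (h : ∀ᵐ x ∂ν, F x ≤ K x * W x) {a b c : ℝ} (ha : 0 < a) (hb : 0 ≤ b) (hc : 0 ≤ c)
    (habc : a + b + c = 1) :
    ∫⁻ x, F x ^ (b + c) ∂ν ≤
      (∫⁻ x, K x ^ (b / a) ∂ν) ^ a * (∫⁻ x, W x ∂ν) ^ b * (∫⁻ x, F x ∂ν) ^ c := by
  calc ∫⁻ x, F x ^ (b + c) ∂ν
      ≤ ∫⁻ x, ∏ i : Fin 3, ![fun x => K x ^ (b / a), W, F] i x ^ ![a, b, c] i ∂ν := by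
        refine lintegral_mono_ae (h.mono fun x hx => ?_)
        simp only [Fin.prod_univ_three, Matrix.cons_val]
        rw [ENNReal.rpow_add_of_nonneg _ _ hb hc, ← ENNReal.rpow_mul, div_mul_cancel₀ b ha.ne',
          ← ENNReal.mul_rpow_of_nonneg _ _ hb]
        gcongr
    _ ≤ _ := ENNReal.lintegral_prod_norm_pow_le _
        (by simp only [Finset.mem_univ, true_imp_iff, Fin.forall_fin_succ, Matrix.cons_val_zero,
              Matrix.cons_val_succ]
            exact ⟨hK.pow_const _, hW, hF, fun i => i.elim0⟩)
        (by simpa [Fin.sum_univ_three] using habc)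
        (by simp [Fin.forall_fin_succ, ha.le, hb, hc])
    _ = _ := by simp only [Fin.prod_univ_three, Matrix.cons_val]

theorem sq_norm_le_sq_envelope_mul (hs : 0 ≤ s) (hC : 0 < C) {x v : ℝ} (hv : C⁻¹ * |x| ^ s ≤ v)
    (z : ℂ) : ‖z‖ ^ 2 ≤ envelope s C x ^ 2 * (‖z‖ ^ 2 + ‖(√v : ℂ) * z‖ ^ 2) := by
  have henv : envelope s C x ^ 2 = (2 * C + 4) ^ 2 * max 1 |x| ^ (-s) := by
    rw [envelope, mul_pow, ← Real.rpow_mul_natCast (by positivity)]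
    norm_num
  rw [henv]
  rcases le_total |x| 1 with hx | hx
  · rw [max_eq_left hx, Real.one_rpow]
    exact (le_add_of_nonneg_right (sq_nonneg _)).trans
      (le_mul_of_one_le_left (by positivity) (by nlinarith))
  · rw [max_eq_right hx]
    have hx0 : 0 < |x| := one_pos.trans_le hx
    calc ‖z‖ ^ 2 ≤ C * |x| ^ (-s) * ‖(√v : ℂ) * z‖ ^ 2 :=
          sq_norm_le_mul_sq_norm_sqrt_mul hs hC hx0 le_rfl hv z
      _ ≤ (2 * C + 4) ^ 2 * |x| ^ (-s) * (‖z‖ ^ 2 + ‖(√v : ℂ) * z‖ ^ 2) := by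
          gcongr
          · nlinarith
          · exact le_add_of_nonneg_left (sq_nonneg _)

theorem lintegral_sq_enorm_coe (f : L2) : ∫⁻ x, ‖f x‖ₑ ^ 2 = ‖f‖ₑ ^ 2 := by
  rw [Lp.enorm_def, eLpNorm_eq_lintegral_rpow_enorm_toReal two_ne_zero (by simp),
    ← ENNReal.rpow_mul_natCast]
  simp

theorem lintegral_enorm_rpow_le_of_mem_energyGraph (hs : 0 ≤ s) (hC : 0 < C)
    (hV : ∀ᵐ x : ℝ, C⁻¹ * |x| ^ s ≤ V x) {p : L2 × EnergySpace} (hp : p ∈ energyGraph V)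
    {a b c : ℝ} (ha : 0 < a) (hb : 0 ≤ b) (hc : 0 ≤ c) (habc : a + b + c = 1) :
    ∫⁻ x, ‖p.1 x‖ₑ ^ (2 * (b + c)) ≤
      (∫⁻ x, ENNReal.ofReal (envelope s C x ^ (2 * b / a))) ^ a *
        (‖p.1‖ₑ ^ 2 + ‖p.2.snd‖ₑ ^ 2) ^ b * (‖p.1‖ₑ ^ 2) ^ c := by
  have hle : ∀ᵐ x, ‖p.1 x‖ₑ ^ 2 ≤
      ENNReal.ofReal (envelope s C x ^ 2) * (‖p.1 x‖ₑ ^ 2 + ‖p.2.snd x‖ₑ ^ 2) := by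
    filter_upwards [hV, hp.2] with x hVx hk
    simp only [← ofReal_norm, ← ENNReal.ofReal_pow (norm_nonneg _)]
    rw [← ENNReal.ofReal_add (by positivity) (by positivity), ← ENNReal.ofReal_mul (by positivity),
      hk]
    exact ENNReal.ofReal_le_ofReal (sq_norm_le_sq_envelope_mul hs hC hVx _)
  have hmeas (f : L2) : AEMeasurable (fun x => ‖f x‖ₑ ^ 2) volume :=
    (Lp.aestronglyMeasurable f).enorm.pow_const 2
  have henv : AEMeasurable (fun x => ENNReal.ofReal (envelope s C x ^ 2)) volume := by
    have := (continuous_envelope s C).measurable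
    fun_prop
  have hmain := lintegral_rpow_add_le_of_le_mul (hmeas p.1) henv
    ((hmeas p.1).add (hmeas p.2.snd)) hle ha hb hc habc
  have hpow (x : ℝ) : ENNReal.ofReal (envelope s C x ^ 2) ^ (b / a) =
      ENNReal.ofReal (envelope s C x ^ (2 * b / a)) := by
    have := (envelope_pos (s := s) hC x).le
    rw [ENNReal.ofReal_rpow_of_nonneg (by positivity) (by positivity), ← Real.rpow_natCast_mul this,
      Nat.cast_ofNat, mul_div_assoc]
  simp only [hpow, Pi.add_apply, ← ENNReal.rpow_natCast_mul, Nat.cast_ofNat] at hmain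
  rw [lintegral_add_left' (hmeas p.1)] at hmain
  simpa only [lintegral_sq_enorm_coe] using hmain

theorem exists_lintegral_enorm_rpow_le (hs : 0 < s) (hC : 0 < C)
    (hV : ∀ᵐ x : ℝ, C⁻¹ * |x| ^ s ≤ V x) {q : ℝ} (hq : q < 2) (hsq : 2 < q * (1 + s)) :
    ∃ D ≠ (⊤ : ℝ≥0∞), ∃ b c : ℝ, 0 ≤ b ∧ 0 < c ∧ ∀ p ∈ energyGraph V,
      ∫⁻ x, ‖p.1 x‖ₑ ^ q ≤ D * (‖p.1‖ₑ ^ 2 + ‖p.2‖ₑ ^ 2) ^ b * (‖p.1‖ₑ ^ 2) ^ c := by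
  have ha : 0 < 1 - q / 2 := by linarith
  have hlt : (1 - q / 2) / s < q / 2 := by
    rw [div_lt_iff₀ hs]
    linarith
  obtain ⟨b, hb, hbq⟩ := exists_between hlt
  have hb0 : 0 < b := (div_pos ha hs).trans hb
  have hint : Integrable fun x => envelope s C x ^ (2 * b / (1 - q / 2)) := by
    refine integrable_envelope_rpow hC ?_
    rw [div_lt_iff₀ hs] at hb
    rw [← mul_div_assoc, one_lt_div ha]
    linarith
  have hD : (∫⁻ x, ENNReal.ofReal (envelope s C x ^ (2 * b / (1 - q / 2)))) ^ (1 - q / 2) ≠ ⊤ :=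
    ENNReal.rpow_ne_top_of_nonneg ha.le hint.lintegral_lt_top.ne
  refine ⟨_, hD, b, q / 2 - b, hb0.le, sub_pos.mpr hbq, fun p hp => ?_⟩
  have hle := lintegral_enorm_rpow_le_of_mem_energyGraph hs.le hC hV hp ha hb0.le
    (sub_pos.mpr hbq).le (by ring)
  rw [show 2 * (b + (q / 2 - b)) = q by ring] at hle
  refine hle.trans ?_
  gcongr
  exact WithLp.enorm_snd_le _ p.2

theorem memLp_of_mem_energyGraph (hs : 0 < s) (hC : 0 < C) (hV : ∀ᵐ x : ℝ, C⁻¹ * |x| ^ s ≤ V x)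
    {q : ℝ} (hq0 : 0 < q) (hq : q < 2) (hsq : 2 < q * (1 + s)) {p : L2 × EnergySpace}
    (hp : p ∈ energyGraph V) : MemLp p.1 (ENNReal.ofReal q) := by
  obtain ⟨D, hD, b, c, hb, hc, hle⟩ := exists_lintegral_enorm_rpow_le hs hC hV hq hsq
  refine ⟨Lp.aestronglyMeasurable p.1, ?_⟩
  rw [eLpNorm_lt_top_iff_lintegral_rpow_enorm_lt_top (by simpa) ENNReal.ofReal_ne_top,
    ENNReal.toReal_ofReal hq0.le]
  refine (hle p hp).trans_lt (lt_top_iff_ne_top.mpr ?_)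
  finiteness

theorem IsEigenSystem.tendsto_eLpNorm_sub_sum {lam : ℕ → ℝ} {u : HilbertBasis ℕ ℂ L2}
    {e : ℕ → EnergySpace} (h : IsEigenSystem V lam u e) (hs : 0 < s) (hC : 0 < C)
    (hV : ∀ᵐ x : ℝ, C⁻¹ * |x| ^ s ≤ V x) {q : ℝ} (hq0 : 0 < q) (hq : q < 2)
    (hsq : 2 < q * (1 + s)) {p : L2 × EnergySpace} (hp : p ∈ energyGraph V) :
    Tendsto (fun t : Finset ℕ =>
      eLpNorm (p.1 - ∑ n ∈ t, ⟪u n, p.1⟫_ℂ • u n : L2) (ENNReal.ofReal q) volume) atTop (𝓝 0) := by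
  obtain ⟨D, hD, b, c, hb, hc, hle⟩ := exists_lintegral_enorm_rpow_le hs hC hV hq hsq
  have hL2 : Tendsto (fun t : Finset ℕ => ‖p.1 - ∑ n ∈ t, ⟪u n, p.1⟫_ℂ • u n‖ₑ) atTop (𝓝 0) := by
    have hsum := u.hasSum_repr p.1
    simp only [u.repr_apply_apply] at hsum
    simpa using ((tendsto_const_nhds (x := p.1)).sub hsum).enorm
  have henergy (t : Finset ℕ) : ‖p.2 - ∑ n ∈ t, ⟪u n, p.1⟫_ℂ • e n‖ₑ ≤ ‖p.2‖ₑ :=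
    enorm_le_iff_norm_le.mpr (h.norm_sub_sum_le t hp)
  have hint : Tendsto (fun t : Finset ℕ =>
      ∫⁻ x, ‖(p.1 - ∑ n ∈ t, ⟪u n, p.1⟫_ℂ • u n : L2) x‖ₑ ^ q) atTop (𝓝 0) := by
    have hsq : Tendsto (fun t : Finset ℕ => ‖p.1 - ∑ n ∈ t, ⟪u n, p.1⟫_ℂ • u n‖ₑ ^ 2) atTop
        (𝓝 0) := by simpa using ENNReal.Tendsto.pow (n := 2) hL2
    have hbound := ENNReal.Tendsto.mul (ENNReal.Tendsto.const_mul (a := D)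
      ((hsq.add_const (‖p.2‖ₑ ^ 2)).ennrpow_const b) (.inr hD))
      (.inr (by simp [hc])) (hsq.ennrpow_const c) (.inr (by finiteness))
    rw [ENNReal.zero_rpow_of_pos hc, mul_zero] at hbound
    refine tendsto_of_tendsto_of_tendsto_of_le_of_le tendsto_const_nhds hbound
      (fun _ => zero_le) fun t => ?_
    refine (hle _ (Submodule.sub_mem _ hp (h.sum_mem t _))).trans ?_
    dsimp only [Prod.fst_sub, Prod.snd_sub]
    gcongr
    exact henergy t
  have hrpow := hint.ennrpow_const (1 / q)
  rw [ENNReal.zero_rpow_of_pos (by positivity)] at hrpow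
  simpa only [eLpNorm_eq_lintegral_rpow_enorm_toReal (ENNReal.ofReal_pos.mpr hq0).ne'
    ENNReal.ofReal_ne_top, ENNReal.toReal_ofReal hq0.le] using hrpow

theorem integrable_conj_mul {q r : ℝ≥0∞} [ENNReal.HolderConjugate q r] {f g : ℝ → ℂ}
    (hf : MemLp f q) (hg : MemLp g r) : Integrable fun x => conj (f x) * g x :=
  hf.star.integrable_mul hg

theorem enorm_integral_conj_mul_le {q r : ℝ≥0∞} [ENNReal.HolderConjugate q r] {f g : ℝ → ℂ}
    (hf : MemLp f q) (hg : MemLp g r) :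
    ‖∫ x, conj (f x) * g x‖ₑ ≤ eLpNorm f q volume * eLpNorm g r volume := by
  calc ‖∫ x, conj (f x) * g x‖ₑ ≤ ∫⁻ x, ‖conj (f x) * g x‖ₑ :=
        enorm_integral_le_lintegral_enorm _
    _ = eLpNorm (star f • g) 1 volume := eLpNorm_one_eq_lintegral_enorm.symm
    _ ≤ eLpNorm (star f) q volume * eLpNorm g r volume :=
        eLpNorm_smul_le_mul_eLpNorm hg.1 hf.star.1
    _ = eLpNorm f q volume * eLpNorm g r volume := by rw [eLpNorm_star]

theorem tendsto_integral_conj_mul {q r : ℝ≥0∞} [ENNReal.HolderConjugate q r] [Fact (1 ≤ r)]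
    {g : ℝ → ℂ} (hg : MemLp g q) {ι : Type*} {l : Filter ι} {F : ι → Lp ℂ r (volume : Measure ℝ)}
    {f : Lp ℂ r (volume : Measure ℝ)} (hF : Tendsto F l (𝓝 f)) :
    Tendsto (fun i => ∫ x, conj (g x) * F i x) l (𝓝 (∫ x, conj (g x) * f x)) := by
  have : Fact (1 ≤ q) := ⟨ENNReal.HolderConjugate.one_le q r⟩
  have hpair (f : Lp ℂ r (volume : Measure ℝ)) :
      (ContinuousLinearMap.mul ℂ ℂ).lpPairing volume q r (hg.star.toLp _) f =
        ∫ x, conj (g x) * f x := by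
    rw [ContinuousLinearMap.lpPairing_eq_integral]
    refine integral_congr_ae ?_
    filter_upwards [hg.star.coeFn_toLp] with x hx
    rw [hx]
    rfl
  have hcont := ((ContinuousLinearMap.mul ℂ ℂ).lpPairing volume q r (hg.star.toLp _)).continuous
  simpa only [hpair, Function.comp_def] using (hcont.tendsto f).comp hF

theorem ae_exists_ne_zero (u : HilbertBasis ℕ ℂ L2) : ∀ᵐ x : ℝ, ∃ n, u n x ≠ 0 := by
  let Z : Set ℝ := {x | ∀ n, u n x = 0}
  have hZ : MeasurableSet Z := by
    have := fun n => (Lp.stronglyMeasurable (u n)).measurable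
    measurability
  have hw : MemLp (Z.indicator fun x => (envelope 2 1 x : ℂ)) 2 :=
    ((memLp_envelope zero_lt_two one_pos (by norm_num)).ofReal (K := ℂ)).indicator hZ
  have horth : hw.toLp _ = 0 := by
    refine u.repr.injective (lp.ext (funext fun n => ?_))
    rw [u.repr_apply_apply, map_zero, inner_L2_eq_integral]
    refine integral_eq_zero_of_ae ?_
    filter_upwards [hw.coeFn_toLp] with x hx
    rw [hx]
    by_cases hxZ : x ∈ Z
    · simp [hxZ n]
    · simp [hxZ]
  filter_upwards [hw.coeFn_toLp, (Lp.eq_zero_iff_ae_eq_zero).mp horth] with x hwx hx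
  rw [hwx] at hx
  by_contra! hxZ
  rw [Set.indicator_of_mem (show x ∈ Z from hxZ)] at hx
  exact (envelope_pos one_pos x).ne' (Complex.ofReal_eq_zero.mp hx)

theorem integral_conj_mul_sum_smul (u : HilbertBasis ℕ ℂ L2) {q r : ℝ≥0∞}
    [ENNReal.HolderConjugate q r] (hu : ∀ n, MemLp (u n) q) {v : ℕ → Lp ℂ r (volume : Measure ℝ)}
    (hv : ∀ n, (v n : ℝ → ℂ) =ᵐ[volume] u n) {t : Finset ℕ} (c : ℕ → ℂ) {m : ℕ} (hm : m ∈ t) :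
    ∫ x, conj (u m x) * (∑ n ∈ t, c n • v n : Lp ℂ r (volume : Measure ℝ)) x = c m := by
  have hsum : (fun x => conj (u m x) * (∑ n ∈ t, c n • v n : Lp ℂ r (volume : Measure ℝ)) x)
      =ᵐ[volume] fun x => ∑ n ∈ t, c n * (conj (u m x) * u n x) := by
    filter_upwards [coeFn_sum_smul t c v, ae_all_iff.mpr hv] with x hx hvx
    simp only [hx, hvx, Finset.mul_sum, mul_left_comm]
  have hint (n : ℕ) : Integrable fun x => c n * (conj (u m x) * u n x) :=
    (integrable_conj_mul (hu m) ((Lp.memLp (v n)).ae_eq (hv n))).const_mul _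
  rw [integral_congr_ae hsum, integral_finsetSum _ fun n _ => hint n]
  simp_rw [integral_const_mul, ← inner_L2_eq_integral, orthonormal_iff_ite.mp u.orthonormal]
  simp [hm]

theorem hasCoeffs_of_tendsto {u : HilbertBasis ℕ ℂ L2} {q r : ℝ≥0∞}
    [ENNReal.HolderConjugate q r] [Fact (1 ≤ r)] (hu : ∀ n, MemLp (u n) q)
    {v : ℕ → Lp ℂ r (volume : Measure ℝ)} (hv : ∀ n, (v n : ℝ → ℂ) =ᵐ[volume] u n)
    {ι : Type*} {l : Filter ι} [l.NeBot] {t : ι → Finset ℕ} (ht : Tendsto t l atTop) {α : ℕ → ℂ}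
    {f : Lp ℂ r (volume : Measure ℝ)}
    (hf : Tendsto (fun i => ∑ n ∈ t i, α n • v n) l (𝓝 f)) : HasCoeffs u f α := by
  intro m
  refine ⟨integrable_conj_mul (hu m) (Lp.memLp f), ?_⟩
  refine tendsto_nhds_unique (tendsto_integral_conj_mul (hu m) hf)
    (tendsto_const_nhds.congr' ?_)
  filter_upwards [ht.eventually_ge_atTop {m}] with i hi
  exact (integral_conj_mul_sum_smul u hu hv α (hi (Finset.mem_singleton_self m))).symm

namespace IsEigenSystem

variable {lam : ℕ → ℝ} {u : HilbertBasis ℕ ℂ L2} {e : ℕ → EnergySpace} {q r : ℝ}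

theorem integral_conj_mul_eq_zero (h : IsEigenSystem V lam u e) (hs : 0 < s) (hC : 0 < C)
    (hV : ∀ᵐ x : ℝ, C⁻¹ * |x| ^ s ≤ V x) (hqr : q.HolderConjugate r) (hq : q < 2)
    (hsq : 2 < q * (1 + s)) {f : ℝ → ℂ} (hf : MemLp f (ENNReal.ofReal r)) (hf0 : HasCoeffs u f 0)
    {p : L2 × EnergySpace} (hp : p ∈ energyGraph V) : ∫ x, conj (p.1 x) * f x = 0 := by
  have := hqr.ennrealOfReal
  have hmem {p : L2 × EnergySpace} (hp : p ∈ energyGraph V) : MemLp p.1 (ENNReal.ofReal q) :=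
    memLp_of_mem_energyGraph hs hC hV hqr.pos hq hsq hp
  have hsub (t : Finset ℕ) : ∫ x, conj (p.1 x) * f x =
      ∫ x, conj ((p.1 - ∑ n ∈ t, ⟪u n, p.1⟫_ℂ • u n : L2) x) * f x := by
    have hexpand : (fun x => conj ((p.1 - ∑ n ∈ t, ⟪u n, p.1⟫_ℂ • u n : L2) x) * f x) =ᵐ[volume]
        fun x => conj (p.1 x) * f x - ∑ n ∈ t, conj ⟪u n, p.1⟫_ℂ * (conj (u n x) * f x) := by
      filter_upwards [Lp.coeFn_sub p.1 (∑ n ∈ t, ⟪u n, p.1⟫_ℂ • u n),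
        coeFn_sum_smul t (fun n => ⟪u n, p.1⟫_ℂ) (fun n => u n)] with x hx hsum
      simp only [hx, Pi.sub_apply, hsum, map_sub, map_sum, map_mul, sub_mul, Finset.sum_mul,
        mul_assoc]
    have hint (n : ℕ) : Integrable fun x => conj ⟪u n, p.1⟫_ℂ * (conj (u n x) * f x) :=
      (hf0 n).1.const_mul _
    rw [integral_congr_ae hexpand, integral_sub (integrable_conj_mul (hmem hp) hf)
      (integrable_finsetSum _ fun n _ => hint n), integral_finsetSum _ fun n _ => hint n]
    simp only [integral_const_mul, (hf0 _).2, Pi.zero_apply, mul_zero, Finset.sum_const_zero,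
      sub_zero]
  have hbound (t : Finset ℕ) : ‖∫ x, conj (p.1 x) * f x‖ₑ ≤
      eLpNorm (p.1 - ∑ n ∈ t, ⟪u n, p.1⟫_ℂ • u n : L2) (ENNReal.ofReal q) volume *
        eLpNorm f (ENNReal.ofReal r) volume := by
    rw [hsub t]
    exact enorm_integral_conj_mul_le (hmem (Submodule.sub_mem _ hp (h.sum_mem t _))) hf
  have hlim := ENNReal.Tendsto.mul_const
    (h.tendsto_eLpNorm_sub_sum hs hC hV hqr.pos hq hsq hp) (.inr hf.2.ne)
  rw [zero_mul] at hlim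
  exact enorm_eq_zero.mp (le_antisymm (ge_of_tendsto' hlim hbound) zero_le)

theorem ae_eq_zero_of_hasCoeffs_zero (h : IsEigenSystem V lam u e) (hs : 0 < s) (hC : 0 < C)
    (hV : ∀ᵐ x : ℝ, C⁻¹ * |x| ^ s ≤ V x) (hqr : q.HolderConjugate r) (hq : q < 2)
    (hsq : 2 < q * (1 + s)) {f : ℝ → ℂ} (hf : MemLp f (ENNReal.ofReal r))
    (hf0 : HasCoeffs u f 0) : f =ᵐ[volume] 0 := by
  have hmul : ∀ n, ∀ᵐ x, conj (u n x) * f x = 0 := fun n => by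
    refine ae_eq_zero_of_integral_contDiff_smul_eq_zero (hf0 n).1.locallyIntegrable
      fun χ hχ hχc => ?_
    obtain ⟨p, hp, hpχ⟩ := exists_mem_energyGraph_mul (h.mem n) (χ := fun x => (χ x : ℂ))
      (Complex.ofRealCLM.contDiff.comp hχ) (hχc.comp_left Complex.ofReal_zero)
    rw [← h.integral_conj_mul_eq_zero hs hC hV hqr hq hsq hf hf0 hp]
    refine integral_congr_ae ?_
    filter_upwards [hpχ] with x hx
    rw [hx, map_mul, Complex.conj_ofReal, Complex.real_smul, mul_assoc]
  filter_upwards [ae_all_iff.mpr hmul, ae_exists_ne_zero u] with x hx ⟨n, hn⟩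
  exact (mul_eq_zero.mp (hx n)).resolve_left ((map_ne_zero _).mpr hn)

theorem eq_of_hasCoeffs (h : IsEigenSystem V lam u e) (hs : 0 < s) (hC : 0 < C)
    (hV : ∀ᵐ x : ℝ, C⁻¹ * |x| ^ s ≤ V x) (hqr : q.HolderConjugate r) (hq : q < 2)
    (hsq : 2 < q * (1 + s)) {α : ℕ → ℂ} {f g : Lp ℂ (ENNReal.ofReal r) (volume : Measure ℝ)}
    (hf : HasCoeffs u f α) (hg : HasCoeffs u g α) : f = g := by
  have hzero : HasCoeffs u (⇑f - ⇑g) 0 := fun n => by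
    simp only [Pi.sub_apply, mul_sub]
    refine ⟨(hf n).1.sub (hg n).1, ?_⟩
    rw [integral_sub (hf n).1 (hg n).1, (hf n).2, (hg n).2, sub_self, Pi.zero_apply]
  refine Lp.ext ?_
  filter_upwards [h.ae_eq_zero_of_hasCoeffs_zero hs hC hV hqr hq hsq
    ((Lp.memLp f).sub (Lp.memLp g)) hzero] with x hx
  exact sub_eq_zero.mp hx

end IsEigenSystem

end Coefficients

section GaussianSums

theorem rpow_le_rpow_mul_exp {y p : ℝ} (hy : 0 ≤ y) (hp : 0 < p) :
    y ^ p ≤ p ^ p * Real.exp y := by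
  have hle : y ≤ p * Real.exp (y / p) := by
    rw [← div_le_iff₀' hp]
    linarith [Real.add_one_le_exp (y / p)]
  calc y ^ p ≤ (p * Real.exp (y / p)) ^ p := by gcongr
    _ = p ^ p * Real.exp y := by
      rw [Real.mul_rpow hp.le (Real.exp_pos _).le, ← Real.exp_mul, div_mul_cancel₀ _ hp.ne']

theorem integral_exp_neg_mul_sq_add_inner {l : ℝ} (hl : 0 < l) (b : ℂ) :
    ∫ z : ℂ, Real.exp (-l * ‖z‖ ^ 2 + 2 * ⟪b, z⟫_ℝ) =
      Real.pi / l * Real.exp (‖b‖ ^ 2 / l) := by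
  have hintegral := GaussianFourier.integral_cexp_neg_mul_sq_norm_add (V := ℂ) (b := (l : ℂ))
    (by simpa using hl) 2 b
  have hl0 : (l : ℂ) ≠ 0 := Complex.ofReal_ne_zero.mpr hl.ne'
  have hexp : (2 : ℂ) ^ 2 * ‖b‖ ^ 2 / (4 * l) = ‖b‖ ^ 2 / l := by field_simp; ring
  refine Complex.ofReal_injective ?_
  rw [← integral_complex_ofReal]
  push_cast
  rw [hintegral, Complex.finrank_real_complex, hexp]
  norm_num

theorem lintegral_exp_complexGaussian {l a : ℝ} (hl : 0 < l) (ha : a < l) (b : ℂ) :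
    ∫⁻ z, ENNReal.ofReal (Real.exp (a * ‖z‖ ^ 2 + 2 * ⟪b, z⟫_ℝ)) ∂complexGaussian l =
      ENNReal.ofReal (l / (l - a) * Real.exp (‖b‖ ^ 2 / (l - a))) := by
  have := Real.pi_pos
  have hla : 0 < l - a := sub_pos.mpr ha
  have hintegral := integral_exp_neg_mul_sq_add_inner hla b
  have hint : Integrable fun z : ℂ => Real.exp (-(l - a) * ‖z‖ ^ 2 + 2 * ⟪b, z⟫_ℝ) :=
    .of_integral_ne_zero (by rw [hintegral]; positivity)
  have hdensity (z : ℂ) : ENNReal.ofReal (l / Real.pi * Real.exp (-l * ‖z‖ ^ 2)) *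
      ENNReal.ofReal (Real.exp (a * ‖z‖ ^ 2 + 2 * ⟪b, z⟫_ℝ)) =
      ENNReal.ofReal (l / Real.pi * Real.exp (-(l - a) * ‖z‖ ^ 2 + 2 * ⟪b, z⟫_ℝ)) := by
    rw [← ENNReal.ofReal_mul (by positivity), mul_assoc, ← Real.exp_add]
    ring_nf
  rw [complexGaussian, lintegral_withDensity_eq_lintegral_mul _ (by fun_prop) (by fun_prop)]
  simp only [Pi.mul_apply, hdensity]
  rw [← ofReal_integral_eq_lintegral_ofReal (hint.const_mul _) (.of_forall fun z => by positivity),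
    integral_const_mul, hintegral]
  congr 1
  field_simp

theorem lintegral_exp_inner_complexGaussian {l : ℝ} (hl : 0 < l) (b : ℂ) :
    ∫⁻ z, ENNReal.ofReal (Real.exp (2 * ⟪b, z⟫_ℝ)) ∂complexGaussian l =
      ENNReal.ofReal (Real.exp (‖b‖ ^ 2 / l)) := by
  simpa [hl.ne'] using lintegral_exp_complexGaussian hl hl b

theorem lintegral_exp_inner_sum_pi {ι : Type*} [Fintype ι] {l : ι → ℝ} (hl : ∀ i, 0 < l i)
    (c : ι → ℂ) (b : ℂ) :
    ∫⁻ α, ENNReal.ofReal (Real.exp (2 * ⟪b, ∑ i, c i * α i⟫_ℝ))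
        ∂Measure.pi (fun i => complexGaussian (l i)) =
      ENNReal.ofReal (Real.exp (‖b‖ ^ 2 * ∑ i, ‖c i‖ ^ 2 / l i)) := by
  have (i : ι) := isProbabilityMeasure_complexGaussian (hl i)
  let φ (i : ι) (z : ℂ) : ℝ≥0∞ := ENNReal.ofReal (Real.exp (2 * ⟪conj (c i) * b, z⟫_ℝ))
  have hφ (i : ι) : Measurable (φ i) := by fun_prop
  have hinner (c z : ℂ) : ⟪b, c * z⟫_ℝ = ⟪conj c * b, z⟫_ℝ := by
    simp only [Complex.inner, map_mul, Complex.conj_conj]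
    ring_nf
  have hprod (α : ι → ℂ) : ENNReal.ofReal (Real.exp (2 * ⟪b, ∑ i, c i * α i⟫_ℝ)) =
      ∏ i, φ i (α i) := by
    rw [← ENNReal.ofReal_prod_of_nonneg fun _ _ => (Real.exp_pos _).le, ← Real.exp_sum,
      _root_.inner_sum, Finset.mul_sum]
    simp_rw [hinner]
  have hindep := ProbabilityTheory.iIndepFun_pi (μ := fun i => complexGaussian (l i))
    fun i => (hφ i).aemeasurable
  simp_rw [hprod]
  rw [ProbabilityTheory.lintegral_prod_eq_prod_lintegral_of_indepFun _ _ hindep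
    fun i => (hφ i).comp (measurable_pi_apply i)]
  have hfactor (i : ι) : ∫⁻ α, φ i (α i) ∂Measure.pi (fun i => complexGaussian (l i)) =
      ENNReal.ofReal (Real.exp (‖b‖ ^ 2 * (‖c i‖ ^ 2 / l i))) := by
    rw [(measurePreserving_eval (fun i => complexGaussian (l i)) i).lintegral_comp (hφ i),
      lintegral_exp_inner_complexGaussian (hl i), norm_mul, RCLike.norm_conj]
    ring_nf
  simp_rw [hfactor]
  rw [← ENNReal.ofReal_prod_of_nonneg fun _ _ => (Real.exp_pos _).le, ← Real.exp_sum,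
    Finset.mul_sum]

namespace IsFreeGibbsMeasure

variable {lam : ℕ → ℝ} {μ : Measure (ℕ → ℂ)}

theorem lintegral_exp_inner_sum (hμ : IsFreeGibbsMeasure lam μ) (hlam : ∀ n, 0 < lam n)
    (t : Finset ℕ) (c : ℕ → ℂ) (b : ℂ) :
    ∫⁻ α, ENNReal.ofReal (Real.exp (2 * ⟪b, ∑ n ∈ t, c n * α n⟫_ℝ)) ∂μ =
      ENNReal.ofReal (Real.exp (‖b‖ ^ 2 * ∑ n ∈ t, ‖c n‖ ^ 2 / lam n)) := by
  classical
  obtain ⟨K, hK⟩ := t.exists_nat_subset_range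
  let d (n : ℕ) : ℂ := if n ∈ t then c n else 0
  have hext {M : Type} [AddCommMonoid M] (F : ℕ → ℂ → M) (hF : ∀ n, F n 0 = 0) :
      ∑ n ∈ t, F n (c n) = ∑ j : Fin (K + 1), F j (d j) := by
    rw [← Finset.sum_range fun n => F n (d n),
      ← Finset.sum_subset (hK.trans (Finset.range_mono K.le_succ))]
    · exact Finset.sum_congr rfl fun n hn => by simp only [d, if_pos hn]
    · exact fun n _ hn => by simp only [d, if_neg hn, hF]
  simp_rw [hext (fun n z => ‖z‖ ^ 2 / lam n) (by simp)]
  simp_rw [fun α : ℕ → ℂ => hext (fun n z => z * α n) (by simp)]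
  rw [← lintegral_exp_inner_sum_pi (fun j : Fin (K + 1) => hlam j), ← hμ.proj K,
    lintegral_map (by fun_prop) (by fun_prop)]

-- Writing `exp (‖z‖² / (2κ))` as a Laplace transform of an independent standard Gaussian `w` turns
-- the integral over `α` into a Laplace transform as well.
theorem lintegral_exp_sq_sum_le (hμ : IsFreeGibbsMeasure lam μ) (hlam : ∀ n, 0 < lam n)
    (t : Finset ℕ) (c : ℕ → ℂ) {κ : ℝ} (hκ : 0 < κ) (hc : ∑ n ∈ t, ‖c n‖ ^ 2 / lam n ≤ κ) :
    ∫⁻ α, ENNReal.ofReal (Real.exp (‖∑ n ∈ t, c n * α n‖ ^ 2 / (2 * κ))) ∂μ ≤ 2 := by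
  have := hμ.isProb
  have := isProbabilityMeasure_complexGaussian one_pos
  set τ := (√(2 * κ))⁻¹ with hτ
  have hnorm (z : ℂ) : ‖τ • z‖ ^ 2 = ‖z‖ ^ 2 / (2 * κ) := by
    rw [norm_smul, mul_pow, Real.norm_eq_abs, sq_abs, hτ, inv_pow, Real.sq_sqrt (by positivity),
      inv_mul_eq_div]
  have hlaplace (z : ℂ) : ENNReal.ofReal (Real.exp (‖z‖ ^ 2 / (2 * κ))) =
      ∫⁻ w, ENNReal.ofReal (Real.exp (2 * ⟪τ • w, z⟫_ℝ)) ∂complexGaussian 1 := by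
    rw [← hnorm, ← div_one (‖τ • z‖ ^ 2), ← lintegral_exp_inner_complexGaussian one_pos]
    refine lintegral_congr fun w => ?_
    rw [real_inner_smul_left, real_inner_smul_left, real_inner_comm]
  simp_rw [hlaplace]
  rw [lintegral_lintegral_swap (by fun_prop)]
  simp_rw [hμ.lintegral_exp_inner_sum hlam, hnorm]
  calc ∫⁻ w, ENNReal.ofReal (Real.exp (‖w‖ ^ 2 / (2 * κ) * ∑ n ∈ t, ‖c n‖ ^ 2 / lam n))
        ∂complexGaussian 1
      ≤ ∫⁻ w, ENNReal.ofReal (Real.exp (1 / 2 * ‖w‖ ^ 2 + 2 * ⟪(0 : ℂ), w⟫_ℝ))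
          ∂complexGaussian 1 := by
        refine lintegral_mono fun w => ENNReal.ofReal_le_ofReal (Real.exp_le_exp.mpr ?_)
        calc _ ≤ ‖w‖ ^ 2 / (2 * κ) * κ := by gcongr
          _ = 1 / 2 * ‖w‖ ^ 2 + 2 * ⟪(0 : ℂ), w⟫_ℝ := by
            rw [inner_zero_left]
            field_simp
            ring
    _ = 2 := by
        rw [lintegral_exp_complexGaussian one_pos (by norm_num)]
        norm_num

theorem lintegral_enorm_sum_rpow_le (hμ : IsFreeGibbsMeasure lam μ) (hlam : ∀ n, 0 < lam n)
    (t : Finset ℕ) (c : ℕ → ℂ) {p : ℝ} (hp : 0 < p) :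
    ∫⁻ α, ‖∑ n ∈ t, c n * α n‖ₑ ^ (2 * p) ∂μ ≤
      ENNReal.ofReal ((2 * p * ∑ n ∈ t, ‖c n‖ ^ 2 / lam n) ^ p) * 2 := by
  have hnonneg : ∀ n ∈ t, 0 ≤ ‖c n‖ ^ 2 / lam n := fun n _ => div_nonneg (sq_nonneg _) (hlam n).le
  rcases (Finset.sum_nonneg hnonneg).eq_or_lt with hκ | hκ
  · have hc : ∀ n ∈ t, c n = 0 := fun n hn => by
      simpa [(hlam n).ne'] using (Finset.sum_eq_zero_iff_of_nonneg hnonneg).mp hκ.symm n hn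
    have hsum (α : ℕ → ℂ) : ∑ n ∈ t, c n * α n = 0 :=
      Finset.sum_eq_zero fun n hn => by rw [hc n hn, zero_mul]
    simp [hsum, hp]
  set κ := ∑ n ∈ t, ‖c n‖ ^ 2 / lam n
  have hpoint (z : ℂ) : ‖z‖ₑ ^ (2 * p) ≤
      ENNReal.ofReal ((2 * p * κ) ^ p) * ENNReal.ofReal (Real.exp (‖z‖ ^ 2 / (2 * κ))) := by
    rw [← ENNReal.ofReal_mul (by positivity), ← ofReal_norm,
      ENNReal.ofReal_rpow_of_nonneg (norm_nonneg _) (by positivity)]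
    refine ENNReal.ofReal_le_ofReal ?_
    calc ‖z‖ ^ (2 * p) = (2 * κ) ^ p * (‖z‖ ^ 2 / (2 * κ)) ^ p := by
          rw [← Real.mul_rpow (by positivity) (by positivity), Real.rpow_mul (norm_nonneg _),
            Real.rpow_two, mul_div_cancel₀ _ (by positivity)]
      _ ≤ (2 * κ) ^ p * (p ^ p * Real.exp (‖z‖ ^ 2 / (2 * κ))) := by
          gcongr
          exact rpow_le_rpow_mul_exp (by positivity) hp
      _ = (2 * p * κ) ^ p * Real.exp (‖z‖ ^ 2 / (2 * κ)) := by
          rw [← mul_assoc, ← Real.mul_rpow (by positivity) hp.le, mul_right_comm]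
  refine (lintegral_mono fun α => hpoint _).trans ?_
  rw [lintegral_const_mul _ (by fun_prop)]
  gcongr
  exact hμ.lintegral_exp_sq_sum_le hlam t c hκ le_rfl

end IsFreeGibbsMeasure

end GaussianSums

section ExponentialMoments

variable {X E : Type*} [MeasurableSpace X] [NormedAddCommGroup E]

-- Hölder's inequality; the exponent is small enough for `M` raised to it to be at most `e`.
theorem lintegral_rpow_inv_one_add_log_le {m : Measure X} [IsFiniteMeasure m] {F : X → ℝ≥0∞}
    (hF : AEMeasurable F m) {M : ℝ} (hM : 0 ≤ M) (hFM : ∫⁻ x, F x ∂m ≤ ENNReal.ofReal M) :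
    ∫⁻ x, F x ^ (1 + Real.log (1 + M))⁻¹ ∂m ≤
      ENNReal.ofReal (Real.exp 1 * (1 + m.real Set.univ)) := by
  have hlog : 0 ≤ Real.log (1 + M) := Real.log_nonneg (by linarith)
  set θ := (1 + Real.log (1 + M))⁻¹
  have hθ0 : 0 ≤ θ := by positivity
  have hθ1 : 0 ≤ 1 - θ := sub_nonneg.mpr (inv_le_one_of_one_le₀ (by linarith))
  have hMθ : M ^ θ ≤ Real.exp 1 := by
    calc M ^ θ ≤ (1 + M) ^ θ := by gcongr; linarith
      _ = Real.exp (Real.log (1 + M) * θ) := Real.rpow_def_of_pos (by linarith) _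
      _ ≤ Real.exp 1 := by
        gcongr
        rw [← div_eq_mul_inv, div_le_one (by positivity)]
        linarith
  have hAθ : m.real Set.univ ^ (1 - θ) ≤ 1 + m.real Set.univ := by
    calc m.real Set.univ ^ (1 - θ) ≤ (1 + m.real Set.univ) ^ (1 - θ) := by gcongr; linarith
      _ ≤ 1 + m.real Set.univ := Real.rpow_le_self_of_one_le
          (le_add_of_nonneg_right measureReal_nonneg) (sub_le_self _ hθ0)
  have hholder := ENNReal.lintegral_mul_norm_pow_le hF (aemeasurable_const (b := 1)) hθ0 hθ1
    (add_sub_cancel θ 1)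
  simp only [ENNReal.one_rpow, mul_one, lintegral_const, one_mul] at hholder
  calc ∫⁻ x, F x ^ θ ∂m ≤ ENNReal.ofReal M ^ θ * ENNReal.ofReal (m.real Set.univ) ^ (1 - θ) := by
        rw [ofReal_measureReal]
        exact hholder.trans (by gcongr)
    _ ≤ ENNReal.ofReal (Real.exp 1) * ENNReal.ofReal (1 + m.real Set.univ) := by
        rw [ENNReal.ofReal_rpow_of_nonneg hM hθ0,
          ENNReal.ofReal_rpow_of_nonneg measureReal_nonneg hθ1]
        gcongr
    _ = _ := (ENNReal.ofReal_mul (by positivity)).symm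

theorem rpow_le_rpow_mul_exp_mul_inv {y p L : ℝ} (hy : 0 ≤ y) (hp : 0 < p) (hL : 0 < L) :
    y ^ p ≤ (L * p) ^ p * Real.exp (y * L⁻¹) := by
  calc y ^ p = L ^ p * (y * L⁻¹) ^ p := by
        rw [← Real.mul_rpow (by positivity) (by positivity)]
        congr 1
        field_simp
    _ ≤ L ^ p * (p ^ p * Real.exp (y * L⁻¹)) := by
        gcongr
        exact rpow_le_rpow_mul_exp (by positivity) hp
    _ = (L * p) ^ p * Real.exp (y * L⁻¹) := by
        rw [← mul_assoc, ← Real.mul_rpow (by positivity) (by positivity)]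

theorem eLpNorm_le_mul_one_add_log {m : Measure X} [IsFiniteMeasure m] {f : X → E}
    (hf : AEStronglyMeasurable f m) {p M : ℝ} (hp : 1 ≤ p) (hM : 0 ≤ M)
    (hexp : ∫⁻ x, ENNReal.ofReal (Real.exp ‖f x‖) ∂m ≤ ENNReal.ofReal M) :
    eLpNorm f (ENNReal.ofReal p) m ≤
      ENNReal.ofReal (p * (Real.exp 1 * (1 + m.real Set.univ)) * (1 + Real.log (1 + M))) := by
  have hp0 : 0 < p := one_pos.trans_le hp
  set A := Real.exp 1 * (1 + m.real Set.univ)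
  have hA : 1 ≤ A := one_le_mul_of_one_le_of_one_le (Real.one_le_exp zero_le_one)
    (le_add_of_nonneg_right measureReal_nonneg)
  have hlog : 0 ≤ Real.log (1 + M) := Real.log_nonneg (by linarith)
  set L := 1 + Real.log (1 + M)
  have hpoint (x : X) : ‖f x‖ₑ ^ p ≤
      ENNReal.ofReal ((L * p) ^ p) * ENNReal.ofReal (Real.exp ‖f x‖) ^ L⁻¹ := by
    rw [← ofReal_norm, ENNReal.ofReal_rpow_of_nonneg (norm_nonneg _) hp0.le,
      ENNReal.ofReal_rpow_of_nonneg (by positivity) (by positivity), ← Real.exp_mul,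
      ← ENNReal.ofReal_mul (by positivity)]
    exact ENNReal.ofReal_le_ofReal
      (rpow_le_rpow_mul_exp_mul_inv (norm_nonneg _) hp0 (by positivity))
  have hint : ∫⁻ x, ‖f x‖ₑ ^ p ∂m ≤ ENNReal.ofReal ((L * p) ^ p * A) := by
    calc ∫⁻ x, ‖f x‖ₑ ^ p ∂m
        ≤ ENNReal.ofReal ((L * p) ^ p) * ∫⁻ x, ENNReal.ofReal (Real.exp ‖f x‖) ^ L⁻¹ ∂m :=
          (lintegral_mono hpoint).trans_eq (lintegral_const_mul' _ _ ENNReal.ofReal_ne_top)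
      _ ≤ ENNReal.ofReal ((L * p) ^ p) * ENNReal.ofReal A := by
          gcongr
          exact lintegral_rpow_inv_one_add_log_le
            (Real.measurable_exp.comp_aemeasurable hf.norm.aemeasurable).ennreal_ofReal hM hexp
      _ = _ := (ENNReal.ofReal_mul (by positivity)).symm
  rw [eLpNorm_eq_lintegral_rpow_enorm_toReal (by simpa using hp0) ENNReal.ofReal_ne_top,
    ENNReal.toReal_ofReal hp0.le]
  refine (ENNReal.rpow_le_rpow hint (by positivity)).trans ?_
  rw [ENNReal.ofReal_rpow_of_nonneg (by positivity) (by positivity)]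
  refine ENNReal.ofReal_le_ofReal ?_
  calc ((L * p) ^ p * A) ^ (1 / p) = L * p * A ^ p⁻¹ := by
        rw [one_div, Real.mul_rpow (by positivity) (by positivity),
          Real.rpow_rpow_inv (by positivity) hp0.ne']
    _ ≤ L * p * A := by
        gcongr
        exact Real.rpow_le_self_of_one_le hA (inv_le_one_of_one_le₀ hp)
    _ = p * A * L := by ring

theorem exp_toReal_eLpNorm_div_le {m : Measure X} [IsFiniteMeasure m] {f : X → E}
    (hf : AEStronglyMeasurable f m) {p : ℝ} (hp : 1 ≤ p) :
    ENNReal.ofReal (Real.exp ((eLpNorm f (ENNReal.ofReal p) m).toReal /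
        (p * (Real.exp 1 * (1 + m.real Set.univ))))) ≤
      ENNReal.ofReal (Real.exp 1) * (1 + ∫⁻ x, ENNReal.ofReal (Real.exp ‖f x‖) ∂m) := by
  have hc : 0 < p * (Real.exp 1 * (1 + m.real Set.univ)) := by positivity
  obtain htop | hfin := eq_or_ne (∫⁻ x, ENNReal.ofReal (Real.exp ‖f x‖) ∂m) ⊤
  · simp [htop, ENNReal.mul_top, Real.exp_pos]
  lift ∫⁻ x, ENNReal.ofReal (Real.exp ‖f x‖) ∂m to NNReal using hfin with M hM
  have hbound := ENNReal.toReal_le_of_le_ofReal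
    (mul_nonneg hc.le (add_nonneg zero_le_one (Real.log_nonneg (by simp))))
    (eLpNorm_le_mul_one_add_log hf hp M.coe_nonneg (by simp [hM]))
  calc ENNReal.ofReal (Real.exp ((eLpNorm f (ENNReal.ofReal p) m).toReal / _))
      ≤ ENNReal.ofReal (Real.exp (1 + Real.log (1 + M))) := by
        gcongr
        rwa [div_le_iff₀' hc]
    _ = ENNReal.ofReal (Real.exp 1) * (1 + M) := by
        rw [Real.exp_add, Real.exp_log (by positivity), ENNReal.ofReal_mul (by positivity),
          ENNReal.ofReal_add zero_le_one M.coe_nonneg, ENNReal.ofReal_one,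
          ENNReal.ofReal_coe_nnreal]

theorem eLpNorm_withDensity_rpow {ν : Measure X} {K : X → ℝ} (hK : ∀ x, 0 ≤ K x)
    (hKm : Measurable K) {p : ℝ} (hp : 0 < p) (g : X → ℝ) :
    eLpNorm g (ENNReal.ofReal p) (ν.withDensity fun x => ENNReal.ofReal (K x ^ p)) =
      eLpNorm (fun x => K x * g x) (ENNReal.ofReal p) ν := by
  rw [eLpNorm_eq_lintegral_rpow_enorm_toReal (by simpa using hp) ENNReal.ofReal_ne_top,
    eLpNorm_eq_lintegral_rpow_enorm_toReal (by simpa using hp) ENNReal.ofReal_ne_top,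
    ENNReal.toReal_ofReal hp.le, lintegral_withDensity_eq_lintegral_mul_non_measurable _
      (by fun_prop) (.of_forall fun _ => ENNReal.ofReal_lt_top)]
  congr 1
  refine lintegral_congr fun x => ?_
  rw [Pi.mul_apply, enorm_mul, ENNReal.mul_rpow_of_nonneg _ _ hp.le, Real.enorm_eq_ofReal (hK x),
    ENNReal.ofReal_rpow_of_nonneg (hK x) hp.le]

theorem eLpNorm_sq_norm {ν : Measure X} {p : ℝ} (hp : 0 ≤ p) (f : X → E) :
    eLpNorm (fun x => ‖f x‖ ^ 2) (ENNReal.ofReal p) ν =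
      eLpNorm f (ENNReal.ofReal (2 * p)) ν ^ 2 := by
  have := eLpNorm_norm_rpow (p := ENNReal.ofReal p) (μ := ν) f two_pos
  simpa only [Real.rpow_ofNat, ENNReal.rpow_ofNat, ← ENNReal.ofReal_mul hp, mul_comm p] using this

theorem two_mul_eLpNorm_sq_norm_div_withDensity {ν : Measure X} {K : X → ℝ} (hK : ∀ x, 0 < K x)
    (hKm : Measurable K) {p : ℝ} (hp : 0 < p) (f : X → E) :
    2 * eLpNorm (fun x => ‖f x‖ ^ 2 / (2 * K x)) (ENNReal.ofReal p)
      (ν.withDensity fun x => ENNReal.ofReal (K x ^ p)) =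
      eLpNorm f (ENNReal.ofReal (2 * p)) ν ^ 2 := by
  have hcancel : (fun x => K x * (‖f x‖ ^ 2 / (2 * K x))) = (2⁻¹ : ℝ) • fun x => ‖f x‖ ^ 2 := by
    funext x
    have := (hK x).ne'
    simp only [Pi.smul_apply, smul_eq_mul]
    field_simp
  rw [eLpNorm_withDensity_rpow (fun x => (hK x).le) hKm hp, hcancel, eLpNorm_const_smul,
    eLpNorm_sq_norm hp.le, ← mul_assoc, Real.enorm_eq_ofReal (by norm_num),
    ENNReal.ofReal_inv_of_pos two_pos, ENNReal.ofReal_ofNat,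
    ENNReal.mul_inv_cancel two_ne_zero ENNReal.ofNat_ne_top, one_mul]

theorem exp_sq_toReal_eLpNorm_le {ν : Measure X} {K : X → ℝ} (hK : ∀ x, 0 < K x)
    (hKm : Measurable K) {p : ℝ} (hp : 1 ≤ p) (hKp : Integrable (fun x => K x ^ p) ν) {f : X → E}
    (hf : AEStronglyMeasurable f ν) :
    ENNReal.ofReal (Real.exp ((2 * p * (Real.exp 1 * (1 + ∫ x, K x ^ p ∂ν)))⁻¹ *
        (eLpNorm f (ENNReal.ofReal (2 * p)) ν).toReal ^ 2)) ≤
      ENNReal.ofReal (Real.exp 1) * (1 + ∫⁻ x, ENNReal.ofReal (K x ^ p) *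
        ENNReal.ofReal (Real.exp (‖f x‖ ^ 2 / (2 * K x))) ∂ν) := by
  have hlint := ofReal_integral_eq_lintegral_ofReal hKp
    (.of_forall fun x => Real.rpow_nonneg (hK x).le p)
  set m := ν.withDensity fun x => ENNReal.ofReal (K x ^ p) with hm
  have : IsFiniteMeasure m := isFiniteMeasure_withDensity (hlint ▸ ENNReal.ofReal_ne_top)
  have hmass : m.real Set.univ = ∫ x, K x ^ p ∂ν := by
    rw [Measure.real, hm, withDensity_apply _ .univ, setLIntegral_univ, ← hlint,
      ENNReal.toReal_ofReal (integral_nonneg fun x => Real.rpow_nonneg (hK x).le p)]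
  have hw : AEStronglyMeasurable (fun x => ‖f x‖ ^ 2 / (2 * K x)) m :=
    ((hf.norm.aemeasurable.pow_const 2).div (by fun_prop)).aestronglyMeasurable.mono_ac
      (withDensity_absolutelyContinuous _ _)
  have hw0 (x : X) : ‖‖f x‖ ^ 2 / (2 * K x)‖ = ‖f x‖ ^ 2 / (2 * K x) :=
    Real.norm_of_nonneg (div_nonneg (sq_nonneg _) (mul_pos two_pos (hK x)).le)
  have hbound := exp_toReal_eLpNorm_div_le hw hp
  simp only [hw0, hmass] at hbound
  rw [hm, lintegral_withDensity_eq_lintegral_mul_non_measurable _ (by fun_prop)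
    (.of_forall fun _ => ENNReal.ofReal_lt_top)] at hbound
  refine le_of_eq_of_le ?_ hbound
  rw [← ENNReal.toReal_pow, ← two_mul_eLpNorm_sq_norm_div_withDensity hK hKm (by linarith) f,
    ENNReal.toReal_mul, ENNReal.toReal_ofNat]
  congr 2
  field_simp

variable {lam : ℕ → ℝ} {μ : Measure (ℕ → ℂ)} {ν : Measure X} [SFinite ν] {g : ℕ → X → ℂ}

theorem IsFreeGibbsMeasure.lintegral_exp_sq_eLpNorm_sum_le (hμ : IsFreeGibbsMeasure lam μ)
    (hlam : ∀ n, 0 < lam n) (hg : ∀ n, Measurable (g n)) {K : X → ℝ} (hK : ∀ x, 0 < K x)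
    (hKm : Measurable K) {p : ℝ} (hp : 1 ≤ p) (hKp : Integrable (fun x => K x ^ p) ν)
    {t : Finset ℕ} (hle : ∀ᵐ x ∂ν, ∑ n ∈ t, ‖g n x‖ ^ 2 / lam n ≤ K x) :
    ∫⁻ α, ENNReal.ofReal (Real.exp ((2 * p * (Real.exp 1 * (1 + ∫ x, K x ^ p ∂ν)))⁻¹ *
        (eLpNorm (fun x => ∑ n ∈ t, g n x * α n) (ENNReal.ofReal (2 * p)) ν).toReal ^ 2)) ∂μ ≤
      ENNReal.ofReal (Real.exp 1) * (1 + ENNReal.ofReal (∫ x, K x ^ p ∂ν) * 2) := by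
  have := hμ.isProb
  have hbound (α : ℕ → ℂ) := exp_sq_toReal_eLpNorm_le hK hKm hp hKp
    (f := fun x => ∑ n ∈ t, g n x * α n) (by fun_prop)
  refine (lintegral_mono hbound).trans ?_
  rw [lintegral_const_mul' _ _ ENNReal.ofReal_ne_top, lintegral_add_left measurable_const,
    lintegral_one, measure_univ, lintegral_lintegral_swap (by fun_prop),
    ofReal_integral_eq_lintegral_ofReal hKp (.of_forall fun x => Real.rpow_nonneg (hK x).le p),
    ← lintegral_mul_const _ (by fun_prop)]
  gcongr ENNReal.ofReal (Real.exp 1) * (1 + ?_)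
  refine lintegral_mono_ae (hle.mono fun x hx => ?_)
  rw [lintegral_const_mul' _ _ ENNReal.ofReal_ne_top]
  gcongr
  exact hμ.lintegral_exp_sq_sum_le hlam t (fun n => g n x) (hK x) hx

theorem IsFreeGibbsMeasure.lintegral_eLpNorm_sum_rpow_le (hμ : IsFreeGibbsMeasure lam μ)
    (hlam : ∀ n, 0 < lam n) (hg : ∀ n, Measurable (g n)) (t : Finset ℕ) {p : ℝ} (hp : 0 < p) :
    ∫⁻ α, eLpNorm (fun x => ∑ n ∈ t, g n x * α n) (ENNReal.ofReal (2 * p)) ν ^ (2 * p) ∂μ ≤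
      ENNReal.ofReal ((2 * p) ^ p) * 2 *
        ∫⁻ x, ENNReal.ofReal (∑ n ∈ t, ‖g n x‖ ^ 2 / lam n) ^ p ∂ν := by
  have := hμ.isProb
  have hpow (f : X → ℂ) : eLpNorm f (ENNReal.ofReal (2 * p)) ν ^ (2 * p) =
      ∫⁻ x, ‖f x‖ₑ ^ (2 * p) ∂ν := by
    rw [eLpNorm_eq_lintegral_rpow_enorm_toReal (by simpa using hp) ENNReal.ofReal_ne_top,
      ENNReal.toReal_ofReal (by positivity), one_div, ENNReal.rpow_inv_rpow (by positivity)]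
  simp_rw [hpow]
  rw [lintegral_lintegral_swap (by fun_prop), ← lintegral_const_mul _ (by fun_prop)]
  refine lintegral_mono fun x => (hμ.lintegral_enorm_sum_rpow_le hlam t (g · x) hp).trans_eq ?_
  have hsum : 0 ≤ ∑ n ∈ t, ‖g n x‖ ^ 2 / lam n :=
    Finset.sum_nonneg fun n _ => div_nonneg (sq_nonneg _) (hlam n).le
  rw [Real.mul_rpow (by positivity) hsum, ENNReal.ofReal_mul (by positivity),
    ENNReal.ofReal_rpow_of_nonneg hsum hp.le]
  ring

end ExponentialMoments

section RandomSeries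

theorem tendsto_lintegral_tsum_nat_add_rpow {X : Type*} [MeasurableSpace X] {ν : Measure X}
    {F : ℕ → X → ℝ≥0∞} (hF : ∀ n, Measurable (F n)) {p : ℝ} (hp : 0 < p)
    (hint : ∫⁻ x, (∑' n, F n x) ^ p ∂ν ≠ ⊤) :
    Tendsto (fun N => ∫⁻ x, (∑' n, F (n + N) x) ^ p ∂ν) atTop (𝓝 0) := by
  have hmeas (N : ℕ) : Measurable fun x => (∑' n, F (n + N) x) ^ p :=
    (Measurable.tsum fun n => hF (n + N)).pow_const p
  rw [← lintegral_zero (μ := ν)]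
  refine tendsto_lintegral_of_dominated_convergence _ hmeas (fun N => .of_forall fun x => ?_)
    hint ?_
  · exact ENNReal.rpow_le_rpow
      (ENNReal.tsum_comp_le_tsum_of_injective (add_left_injective N) _) hp.le
  · filter_upwards [ae_lt_top (hmeas 0) hint] with x hx
    have hsum : ∑' n, F n x ≠ ⊤ := ((ENNReal.rpow_lt_top_iff_of_pos hp).mp hx).ne
    simpa only [ENNReal.zero_rpow_of_pos hp] using
      (ENNReal.tendsto_sum_nat_add _ hsum).ennrpow_const p

theorem sum_Ico_le_tsum_nat_add (F : ℕ → ℝ≥0∞) {N a b : ℕ} (ha : N ≤ a) :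
    ∑ n ∈ Finset.Ico a b, F n ≤ ∑' n, F (n + N) := by
  calc ∑ n ∈ Finset.Ico a b, F n ≤ ∑ n ∈ Finset.Ico (0 + N) (b - N + N), F n := by
        exact Finset.sum_le_sum_of_subset (Finset.Ico_subset_Ico (by omega) (by omega))
    _ = ∑ n ∈ Finset.Ico 0 (b - N), F (n + N) := (Finset.sum_Ico_add' F 0 (b - N) N).symm
    _ ≤ ∑' n, F (n + N) := ENNReal.sum_le_tsum _

theorem exists_strictMono_ae_tendsto_of_eLpNorm_sub_le {Y E : Type*} [MeasurableSpace Y]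
    [NormedAddCommGroup E] [CompleteSpace E] {μ : Measure Y} {q : ℝ≥0∞} (hq : 1 ≤ q)
    {S : ℕ → Y → E} (hS : ∀ n, AEStronglyMeasurable (S n) μ) {B : ℕ → ℝ≥0∞}
    (hB : Tendsto B atTop (𝓝 0))
    (hSB : ∀ N a b, N ≤ a → a ≤ b → eLpNorm (S b - S a) q μ ≤ B N) :
    ∃ φ : ℕ → ℕ, StrictMono φ ∧ ∀ᵐ y ∂μ, ∃ l, Tendsto (fun k => S (φ k) y) atTop (𝓝 l) := by
  obtain ⟨φ, hφ, hφB⟩ := extraction_forall_of_eventually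
    (P := fun k N => B N < (2⁻¹ : ℝ≥0∞) ^ k)
    fun k => hB.eventually_lt_const (ENNReal.pow_pos (by norm_num) k)
  refine ⟨φ, hφ, Lp.ae_tendsto_of_cauchy_eLpNorm (f := fun k => S (φ k)) (fun k => hS _) hq
    (B := fun k => (2⁻¹ : ℝ≥0∞) ^ k) (by simp [ENNReal.tsum_geometric]) fun N a b ha hb => ?_⟩
  refine lt_of_le_of_lt ?_ (hφB N)
  obtain hab | hba := le_total a b
  · rw [eLpNorm_sub_comm]
    exact hSB _ _ _ (hφ.monotone ha) (hφ.monotone hab)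
  · exact hSB _ _ _ (hφ.monotone hb) (hφ.monotone hba)

theorem integrable_of_ae_tendsto_of_lintegral_enorm_le {Y E : Type*} [MeasurableSpace Y]
    [NormedAddCommGroup E] {μ : Measure Y} {F : ℕ → Y → E} {G : Y → E}
    (hF : ∀ k, AEStronglyMeasurable (F k) μ)
    (hlim : ∀ᵐ y ∂μ, Tendsto (fun k => F k y) atTop (𝓝 (G y))) {B : ℝ≥0∞} (hB : B ≠ ⊤)
    (hFB : ∀ k, ∫⁻ y, ‖F k y‖ₑ ∂μ ≤ B) : Integrable G μ := by
  refine ⟨aestronglyMeasurable_of_tendsto_ae _ hF hlim, ?_⟩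
  calc ∫⁻ y, ‖G y‖ₑ ∂μ = ∫⁻ y, liminf (fun k => ‖F k y‖ₑ) atTop ∂μ :=
        lintegral_congr_ae (hlim.mono fun y hy => hy.enorm.liminf_eq.symm)
    _ ≤ liminf (fun k => ∫⁻ y, ‖F k y‖ₑ ∂μ) atTop := lintegral_liminf_le' fun k => (hF k).enorm
    _ ≤ B := liminf_le_of_le (by isBoundedDefault) fun b hb =>
        let ⟨k, hk⟩ := hb.exists
        hk.trans (hFB k)
    _ < ⊤ := hB.lt_top

variable {X : Type*} [MeasurableSpace X] {ν : Measure X}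

theorem enorm_sum_smul_eq_eLpNorm {r : ℝ≥0∞} (v : ℕ → Lp ℂ r ν) (t : Finset ℕ) (α : ℕ → ℂ) :
    ‖∑ n ∈ t, α n • v n‖ₑ = eLpNorm (fun x => ∑ n ∈ t, v n x * α n) r ν := by
  rw [Lp.enorm_def, eLpNorm_congr_ae (coeFn_sum_smul t α v)]
  simp only [mul_comm]

namespace IsFreeGibbsMeasure

variable {lam : ℕ → ℝ} {μ : Measure (ℕ → ℂ)} [SFinite ν] {p : ℝ}
  {v : ℕ → Lp ℂ (ENNReal.ofReal (2 * p)) ν}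

theorem eLpNorm_sum_smul_le [Fact (1 ≤ ENNReal.ofReal (2 * p))] (hμ : IsFreeGibbsMeasure lam μ)
    (hlam : ∀ n, 0 < lam n) (hp : 0 < p) (t : Finset ℕ) :
    eLpNorm (fun α => ∑ n ∈ t, α n • v n) (ENNReal.ofReal (2 * p)) μ ≤
      (ENNReal.ofReal ((2 * p) ^ p) * 2 *
        ∫⁻ x, (∑ n ∈ t, ENNReal.ofReal (‖v n x‖ ^ 2 / lam n)) ^ p ∂ν) ^ (2 * p)⁻¹ := by
  have hmoment := hμ.lintegral_eLpNorm_sum_rpow_le (ν := ν) hlam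
    (fun n => (Lp.stronglyMeasurable (v n)).measurable) t hp
  simp_rw [ENNReal.ofReal_sum_of_nonneg fun n _ => div_nonneg (sq_nonneg _) (hlam n).le,
    ← enorm_sum_smul_eq_eLpNorm] at hmoment
  rw [eLpNorm_eq_lintegral_rpow_enorm_toReal (by simpa using hp) ENNReal.ofReal_ne_top,
    ENNReal.toReal_ofReal (by positivity), one_div]
  exact ENNReal.rpow_le_rpow hmoment (by positivity)

theorem exists_strictMono_ae_tendsto_sum [Fact (1 ≤ ENNReal.ofReal (2 * p))]
    (hμ : IsFreeGibbsMeasure lam μ) (hlam : ∀ n, 0 < lam n) (hp : 0 < p)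
    (hint : ∫⁻ x, (∑' n, ENNReal.ofReal (‖v n x‖ ^ 2 / lam n)) ^ p ∂ν ≠ ⊤) :
    ∃ φ : ℕ → ℕ, StrictMono φ ∧ ∀ᵐ α ∂μ, ∃ f,
      Tendsto (fun k => ∑ n ∈ Finset.range (φ k), α n • v n) atTop (𝓝 f) := by
  have hv (n : ℕ) : Measurable (v n) := (Lp.stronglyMeasurable (v n)).measurable
  set F : ℕ → X → ℝ≥0∞ := fun n x => ENNReal.ofReal (‖v n x‖ ^ 2 / lam n)
  have hF (n : ℕ) : Measurable (F n) := by fun_prop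
  set c := ENNReal.ofReal ((2 * p) ^ p) * 2
  have htail : Tendsto (fun N => (c * ∫⁻ x, (∑' n, F (n + N) x) ^ p ∂ν) ^ (2 * p)⁻¹) atTop
      (𝓝 0) := by
    have := ENNReal.Tendsto.const_mul (a := c) (tendsto_lintegral_tsum_nat_add_rpow hF hp hint)
      (.inr (by finiteness))
    simpa [hp] using this.ennrpow_const (2 * p)⁻¹
  refine exists_strictMono_ae_tendsto_of_eLpNorm_sub_le
    (S := fun N (α : ℕ → ℂ) => ∑ n ∈ Finset.range N, α n • v n)
    (Fact.out : 1 ≤ ENNReal.ofReal (2 * p))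
    (fun N => (by fun_prop : Continuous _).aestronglyMeasurable) htail fun N a b hNa hab => ?_
  have hdiff : ((fun α => ∑ n ∈ Finset.range b, α n • v n) -
      fun α : ℕ → ℂ => ∑ n ∈ Finset.range a, α n • v n) =
        fun α => ∑ n ∈ Finset.Ico a b, α n • v n :=
    funext fun α => (Finset.sum_Ico_eq_sub _ hab).symm
  rw [hdiff]
  refine (hμ.eLpNorm_sum_smul_le hlam hp _).trans ?_
  gcongr with x
  exact sum_Ico_le_tsum_nat_add (F · x) hNa

theorem integrable_exp_sq_norm_of_tendsto_sum [Fact (1 ≤ ENNReal.ofReal (2 * p))]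
    (hμ : IsFreeGibbsMeasure lam μ) (hlam : ∀ n, 0 < lam n) {K : X → ℝ} (hK : ∀ x, 0 < K x)
    (hKm : Measurable K) (hp : 1 ≤ p) (hKp : Integrable (fun x => K x ^ p) ν)
    (hle : ∀ᵐ x ∂ν, ∀ t : Finset ℕ, ∑ n ∈ t, ‖v n x‖ ^ 2 / lam n ≤ K x) {t : ℕ → Finset ℕ}
    {f : (ℕ → ℂ) → Lp ℂ (ENNReal.ofReal (2 * p)) ν}
    (hf : ∀ᵐ α ∂μ, Tendsto (fun k => ∑ n ∈ t k, α n • v n) atTop (𝓝 (f α))) :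
    Integrable (fun α => Real.exp ((2 * p * (Real.exp 1 * (1 + ∫ x, K x ^ p ∂ν)))⁻¹ *
      ‖f α‖ ^ 2)) μ := by
  refine integrable_of_ae_tendsto_of_lintegral_enorm_le
    (F := fun k (α : ℕ → ℂ) => Real.exp (_ * ‖∑ n ∈ t k, α n • v n‖ ^ 2))
    (B := ENNReal.ofReal (Real.exp 1) * (1 + ENNReal.ofReal (∫ x, K x ^ p ∂ν) * 2))
    (fun k => (by fun_prop : Continuous _).aestronglyMeasurable)
    (hf.mono fun α hα => (Real.continuous_exp.tendsto _).comp ((hα.norm.pow 2).const_mul _))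
    (by finiteness) fun k => ?_
  simp_rw [Real.enorm_eq_ofReal (Real.exp_pos _).le, ← toReal_enorm, enorm_sum_smul_eq_eLpNorm]
  exact hμ.lintegral_exp_sq_eLpNorm_sum_le hlam
    (fun n => (Lp.stronglyMeasurable (v n)).measurable) hK hKm hp hKp (hle.mono fun x hx => hx _)

end IsFreeGibbsMeasure

end RandomSeries

section Support

theorem toLr_eq {u : HilbertBasis ℕ ℂ L2} {r : ℝ} {α : ℕ → ℂ}
    {f : Lp ℂ (ENNReal.ofReal r) (volume : Measure ℝ)} (hf : HasCoeffs u f α)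
    (huniq : ∀ g : Lp ℂ (ENNReal.ofReal r) (volume : Measure ℝ), HasCoeffs u g α → g = f) :
    toLr u r α = f := by
  have hex : ∃ g : Lp ℂ (ENNReal.ofReal r) (volume : Measure ℝ), HasCoeffs u g α := ⟨f, hf⟩
  rw [toLr, dif_pos hex]
  exact huniq _ hex.choose_spec

theorem exists_holderConjugate_of_one_sub_mul_lt {r s : ℝ} (hr : 2 < r) (hrs : (1 - s) * r < 2) :
    ∃ q : ℝ, q.HolderConjugate r ∧ q < 2 ∧ 2 < q * (1 + s) := by
  have hr1 : 0 < r - 1 := by linarith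
  refine ⟨r / (r - 1), (Real.HolderConjugate.conjExponent (by linarith)).symm, ?_, ?_⟩
  · rw [div_lt_iff₀ hr1]
    linarith
  · rw [div_mul_eq_mul_div, lt_div_iff₀ hr1]
    linarith

namespace IsEigenSystem

variable {V : ℝ → ℝ} {s C : ℝ} {lam : ℕ → ℝ} {u : HilbertBasis ℕ ℂ L2} {e : ℕ → EnergySpace}

theorem memLp_basis (h : IsEigenSystem V lam u e) (hlam : ∀ n, 0 < lam n) (hs : 0 < s)
    (hC : 0 < C) (hV : ∀ᵐ x : ℝ, C⁻¹ * |x| ^ s ≤ V x) {p : ℝ} (hp : 0 < p) (hps : 2 / s < p)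
    (n : ℕ) : MemLp (u n) (ENNReal.ofReal (2 * p)) := by
  have henv := (memLp_envelope hs hC (ENNReal.ofReal_lt_ofReal_iff hp |>.mpr hps)).const_mul (lam n)
  have hsq : MemLp (fun x => ‖u n x‖ ^ 2) (ENNReal.ofReal p) := by
    refine henv.mono' ((Lp.aestronglyMeasurable (u n)).norm.pow 2) ?_
    filter_upwards [h.ae_sum_le_envelope hlam hs.le hC hV] with x hx
    rw [Real.norm_of_nonneg (sq_nonneg _), ← div_le_iff₀' (hlam n)]
    simpa only [Finset.sum_singleton] using hx {n}
  refine ⟨Lp.aestronglyMeasurable (u n), ?_⟩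
  have := hsq.2
  rwa [eLpNorm_sq_norm hp.le, ENNReal.pow_lt_top_iff, or_iff_left two_ne_zero] at this

variable {μ : Measure (ℕ → ℂ)} {p : ℝ} {v : ℕ → Lp ℂ (ENNReal.ofReal (2 * p)) (volume : Measure ℝ)}

theorem exists_strictMono_ae_tendsto_toLr (h : IsEigenSystem V lam u e) (hlam : ∀ n, 0 < lam n)
    (hμ : IsFreeGibbsMeasure lam μ) (hs : 0 < s) (hC : 0 < C)
    (hV : ∀ᵐ x : ℝ, C⁻¹ * |x| ^ s ≤ V x) (hp : 1 < p) (hps : 2 / s < p)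
    (hrs : (1 - s) * (2 * p) < 2) (hv : ∀ n, v n =ᵐ[volume] u n)
    [Fact (1 ≤ ENNReal.ofReal (2 * p))] :
    ∃ φ : ℕ → ℕ, StrictMono φ ∧ ∀ᵐ α ∂μ,
      (∃! f : Lp ℂ (ENNReal.ofReal (2 * p)) (volume : Measure ℝ), HasCoeffs u f α) ∧
        Tendsto (fun k => ∑ n ∈ Finset.range (φ k), α n • v n) atTop (𝓝 (toLr u (2 * p) α)) := by
  have hp0 : 0 < p := by linarith
  obtain ⟨q, hqr, hq, hqs⟩ := exists_holderConjugate_of_one_sub_mul_lt (by linarith) hrs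
  have := hqr.ennrealOfReal
  have huq (n : ℕ) := memLp_of_mem_energyGraph hs hC hV hqr.pos hq hqs (h.mem n)
  have hgreen : ∫⁻ x, (∑' n, ENNReal.ofReal (‖v n x‖ ^ 2 / lam n)) ^ p ≠ ⊤ := by
    have hmem := h.memLp_greenDiag hlam hs hC hV ((ENNReal.ofReal_lt_ofReal_iff hp0).mpr hps)
    have hfin := lintegral_rpow_enorm_lt_top_of_eLpNorm_lt_top (by simpa using hp0)
      ENNReal.ofReal_ne_top hmem.2
    rw [ENNReal.toReal_ofReal hp0.le] at hfin
    refine (lintegral_congr_ae ?_).trans_ne hfin.ne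
    filter_upwards [ae_all_iff.mpr hv] with x hvx
    simp only [hvx, enorm_eq_self, greenDiag]
  obtain ⟨φ, hφ, hlim⟩ := hμ.exists_strictMono_ae_tendsto_sum hlam hp0 hgreen
  refine ⟨φ, hφ, hlim.mono fun α ⟨f, hf⟩ => ?_⟩
  have hcoeffs : HasCoeffs u f α :=
    hasCoeffs_of_tendsto huq hv (tendsto_finset_range.comp hφ.tendsto_atTop) hf
  have huniq (g : Lp ℂ (ENNReal.ofReal (2 * p)) (volume : Measure ℝ)) (hg : HasCoeffs u g α) :
      g = f := h.eq_of_hasCoeffs hs hC hV hqr hq hqs hg hcoeffs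
  rw [toLr_eq hcoeffs huniq]
  exact ⟨⟨f, hcoeffs, huniq⟩, hf⟩

theorem ae_existsUnique_hasCoeffs_and_integrable_exp (h : IsEigenSystem V lam u e)
    (hlam : ∀ n, 0 < lam n) (hμ : IsFreeGibbsMeasure lam μ) (hs : 0 < s) (hC : 0 < C)
    (hV : ∀ᵐ x : ℝ, C⁻¹ * |x| ^ s ≤ V x) {r : ℝ} (hr : max 2 (4 / s) < r)
    (hrs : (1 - s) * r < 2) :
    (∀ᵐ α ∂μ, ∃! f : Lp ℂ (ENNReal.ofReal r) (volume : Measure ℝ), HasCoeffs u f α) ∧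
      ∃ a : ℝ, 0 < a ∧ Integrable (fun α => Real.exp (a * ‖toLr u r α‖ ^ 2)) μ := by
  obtain ⟨p, rfl⟩ : ∃ p, r = 2 * p := ⟨r / 2, by ring⟩
  obtain ⟨hr2, hr4⟩ := max_lt_iff.mp hr
  have hp : 1 < p := by linarith
  have hps : 2 < p * s := by
    rw [div_lt_iff₀ hs] at hr4
    linarith
  have : Fact (1 ≤ ENNReal.ofReal (2 * p)) := ⟨ENNReal.one_le_ofReal.mpr (by linarith)⟩
  have hur := h.memLp_basis hlam hs hC hV (by linarith) ((div_lt_iff₀ hs).mpr hps)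
  have hv (n : ℕ) : (hur n).toLp =ᵐ[volume] u n := (hur n).coeFn_toLp
  have hle : ∀ᵐ x, ∀ t : Finset ℕ, ∑ n ∈ t, ‖(hur n).toLp _ x‖ ^ 2 / lam n ≤ envelope s C x := by
    filter_upwards [ae_all_iff.mpr hv, h.ae_sum_le_envelope hlam hs.le hC hV] with x hvx hx
    simpa only [hvx] using hx
  obtain ⟨φ, -, hlim⟩ :=
    h.exists_strictMono_ae_tendsto_toLr hlam hμ hs hC hV hp ((div_lt_iff₀ hs).mpr hps) hrs hv
  have hpos : 0 ≤ ∫ x, envelope s C x ^ p :=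
    integral_nonneg fun x => Real.rpow_nonneg (envelope_pos hC x).le p
  exact ⟨hlim.mono fun α hα => hα.1, _, by positivity,
    hμ.integrable_exp_sq_norm_of_tendsto_sum hlam (envelope_pos hC)
      (continuous_envelope s C).measurable hp.le (integrable_envelope_rpow hC (by linarith)) hle
      (hlim.mono fun α hα => hα.2)⟩

end IsEigenSystem

end Support

end FreeGibbs

end

theorem mainTheorem3_general (V : ℝ → ℝ) (s C : ℝ) (hs : 0 < s) (hC : 0 < C)
    (hVm : AEMeasurable V volume) (hV : ∀ᵐ x : ℝ, C⁻¹ * |x| ^ s ≤ V x)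
    (lam : ℕ → ℝ) (u : HilbertBasis ℕ ℂ FreeGibbs.L2)
    (hu : FreeGibbs.IsSpectralDecomposition V lam u)
    (μ₀ : Measure (ℕ → ℂ)) (hμ₀ : FreeGibbs.IsFreeGibbsMeasure lam μ₀) :
    (∀ r : ℝ, max 2 (4 / s) < r → (1 - s) * r < 2 →
      (∀ᵐ α ∂μ₀, ∃! f : Lp ℂ (ENNReal.ofReal r) (volume : Measure ℝ),
        FreeGibbs.HasCoeffs u f α) ∧
      ∃ a : ℝ, 0 < a ∧
        Integrable (fun α => Real.exp (a * ‖FreeGibbs.toLr u r α‖ ^ 2)) μ₀) ∧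
    (∀ p : ℝ≥0∞, ENNReal.ofReal (2 / s) < p →
      MemLp (FreeGibbs.greenDiag lam u) p (volume : Measure ℝ)) := by
  have hVpos : ∀ᵐ x, 0 < V x := by
    filter_upwards [hV, Measure.ae_ne volume (0 : ℝ)] with x hx hx0
    exact (mul_pos (inv_pos.mpr hC) (Real.rpow_pos_of_pos (abs_pos.mpr hx0) s)).trans_le hx
  obtain ⟨e, he⟩ := hu.exists_isEigenSystem hVm (hVpos.mono fun x hx => hx.le)
  have hlam := he.lam_pos hVpos
  exact ⟨fun r hr hrs =>
      he.ae_existsUnique_hasCoeffs_and_integrable_exp hlam hμ₀ hs hC hV hr hrs,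
    fun p hp => he.memLp_greenDiag hlam hs hC hV hp⟩

theorem mainTheorem3 (V : ℝ → ℝ) (s C : ℝ) (hs : 1 < s) (hC : 0 < C)
    (hVm : AEMeasurable V volume) (hV : ∀ᵐ x : ℝ, C⁻¹ * |x| ^ s ≤ V x)
    (lam : ℕ → ℝ) (u : HilbertBasis ℕ ℂ FreeGibbs.L2)
    (hu : FreeGibbs.IsSpectralDecomposition V lam u)
    (μ₀ : Measure (ℕ → ℂ)) (hμ₀ : FreeGibbs.IsFreeGibbsMeasure lam μ₀) :
    (∀ r : ℝ, max 2 (4 / s) < r →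
      (∀ᵐ α ∂μ₀, ∃! f : Lp ℂ (ENNReal.ofReal r) (volume : Measure ℝ),
        FreeGibbs.HasCoeffs u f α) ∧
      ∃ a : ℝ, 0 < a ∧
        Integrable (fun α => Real.exp (a * ‖FreeGibbs.toLr u r α‖ ^ 2)) μ₀) ∧
    (∀ p : ℝ≥0∞, ENNReal.ofReal (max 1 (2 / s)) < p →
      MemLp (FreeGibbs.greenDiag lam u) p (volume : Measure ℝ)) := by
  obtain ⟨hsupport, hgreen⟩ :=
    mainTheorem3_general V s C (by linarith) hC hVm hV lam u hu μ₀ hμ₀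
  exact ⟨fun r hr => hsupport r hr (by nlinarith [(le_max_left 2 (4 / s)).trans_lt hr]),
    fun p hp => hgreen p ((ENNReal.ofReal_le_ofReal (le_max_right 1 (2 / s))).trans_lt hp)⟩
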